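/- Let $\mathsf G(z)$ be a $p\times m$ proper real rational transfer function matrix of minimal order $n$ (the least state dimension of a state-space realization), let $(A,B,C,D)$ be a minimal realization of it, i.e. $C(zI-A)^{-1}B+D=\mathsf G(z)$ with state dimension $n$, and let the lag $l$ be its observability index. For each output $i\in\{1,\dots,p\}$ let $n_i$ be the minimal order of the $i$-th row $\mathsf G_i(z)$ of $\mathsf G(z)$ and write $\mathsf G_i(z)=\mathsf N_i(z)/\mathsf D_i(z)$, where $\mathsf D_i$ is a monic real polynomial of degree $n_i$ and $\mathsf N_i$ is a $1\times m$ vector of real polynomials of degree at most $n_i$. Let $N\ge l$ and, if $p\ge 2$, let also $N\ge n_i$ for all $i$ (for $p=1$ this is automatic). Let $\begin{bmatrix}U_{\mathrm p}\\U_{\mathrm f}\end{bmatrix}\in\mathbb R^{m(N+1)\times T}$ and $\begin{bmatrix}Y_{\mathrm p}\\Y_{\mathrm f}\end{bmatrix}\in\mathbb R^{p(N+1)\times T}$ be data matrices such that each pair of corresponding columns is an input-output trajectory of length $N+1$ of the system $x(t+1)=Ax(t)+Bu(t)$, $y(t)=Cx(t)+Du(t)$ (with arbitrary initial state), where $U_{\mathrm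 p},Y_{\mathrm p}$ consist of the first $N$ block rows and $U_{\mathrm f},Y_{\mathrm f}$ of the last one. Assume that $$\operatorname{rank}\begin{bmatrix}U_{\mathrm p}\\U_{\mathrm f}\\Y_{\mathrm p}\end{bmatrix}=m(N+1)+n .$$ For each $i$ let $Y_{\mathrm p,i}\in\mathbb R^{N\times T}$ and $Y_{\mathrm f,i}\in\mathbb R^{1\times T}$ be the rows of $Y_{\mathrm p}$ and $Y_{\mathrm f}$ that belong to the $i$-th output, let $\mathrm H_i=\begin{bmatrix}U_{\mathrm p}\\U_{\mathrm f}\\Y_{\mathrm p,i}\end{bmatrix}$, and, with the Moore-Penrose inverse $\mathrm H_i^\dagger$, define $a_{k,i}\in\mathbb R$ and $b_{k,i}\in\mathbb R^m$ by $$Y_{\mathrm f,i}\mathrm H_i^\dagger=[\,b_{0,i}^\top,\dots,b_{N-1,i}^\top,\,b_{N,i}^\top,\,a_{0,i},\dots,a_{N-1,i}\,].$$ Let $\mathcal A=\operatorname{diag}(\mathcal A_1,\dots,\mathcal A_p)$ and $\mathcal B=[\mathcal B_1^\top,\dots,\mathcal B_p^\top]^\top$, where $(\mathcal A_i,\mathcal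 B_i)$ are the matrices of the update $\chi_i(t+1)=\mathcal A_i\chi_i(t)+\mathcal B_iu(t)$ on $\mathbb R^{N(m+1)}$ which, for $\chi_i(t)=\operatorname{col}(y_i(t-N),\dots,y_i(t-1),u(t-N),\dots,u(t-1))$, shifts both blocks by one step and appends $u(t)$ to the second block and $$y_i(t)=\sum_{k=0}^{N-1}a_{k,i}\,y_i(t-N+k)+\sum_{k=0}^{N}b_{k,i}^\top u(t-N+k)$$ to the first. Then the pair $(\mathcal A,\mathcal B)$ is stabilizable (there is a real matrix $\mathcal K$ such that all eigenvalues of $\mathcal A-\mathcal B\mathcal K$ have modulus less than $1$) if at least one of the following conditions holds: 1. $p=1$; 2. for every $\lambda\in\mathbb C$ with $|\lambda|\ge 1$, the vectors $\mathsf N_i(\lambda)$, indexed by those $i$ with $\mathsf D_i(\lambda)=0$, are linearly independent over $\mathbb C$. -/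

import Mathlib

open Matrix Polynomial

noncomputable section

/-! ## Discrete-time linear time-invariant systems -/

/-- The matrices of `x(t+1) = A x(t) + B u(t)`, `y(t) = C x(t) + D u(t)`, with input in `ℝ^m`,
output in `ℝ^p` and state in `ℝ^k`. -/
structure StateSpace (m p k : ℕ) where
  A : Matrix (Fin k) (Fin k) ℝ
  B : Matrix (Fin k) (Fin m) ℝ
  C : Matrix (Fin p) (Fin k) ℝ
  D : Matrix (Fin p) (Fin m) ℝ

/-- The transfer function matrix `C (zI - A)⁻¹ B + D`. -/
def StateSpace.transferMatrix {m p k : ℕ} (S : StateSpace m p k) :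
    Matrix (Fin p) (Fin m) (RatFunc ℝ) :=
  S.C.map RatFunc.C *
      ((RatFunc.X : RatFunc ℝ) • (1 : Matrix (Fin k) (Fin k) (RatFunc ℝ)) -
        S.A.map RatFunc.C)⁻¹ *
      S.B.map RatFunc.C +
    S.D.map RatFunc.C

/-- The minimal order of a transfer function matrix: the least state dimension of a state-space
realization. -/
def minimalOrder {m p : ℕ} (G : Matrix (Fin p) (Fin m) (RatFunc ℝ)) : ℕ :=
  sInf {k | ∃ S : StateSpace m p k, S.transferMatrix = G}

/-- The `i`-th row of `G`, as the transfer function matrix of a single-output system. -/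
def outputRow {m p : ℕ} (G : Matrix (Fin p) (Fin m) (RatFunc ℝ)) (i : Fin p) :
    Matrix (Fin 1) (Fin m) (RatFunc ℝ) :=
  Matrix.of fun _ j => G i j

/-- The observability matrix `col(C, CA, …, CA^{l-1})`. -/
def StateSpace.observabilityMatrix {m p k : ℕ} (S : StateSpace m p k) (l : ℕ) :
    Matrix (Fin l × Fin p) (Fin k) ℝ :=
  Matrix.of fun r c => (S.C * S.A ^ (r.1 : ℕ)) r.2 c

/-- The observability index of an observable realization: the least `l` for which
`col(C, CA, …, CA^{l-1})` has full column rank. -/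
def StateSpace.observabilityIndex {m p k : ℕ} (S : StateSpace m p k) : ℕ :=
  sInf {l | (S.observabilityMatrix l).rank = k}

/-- The input-output trajectories of length `L`, with arbitrary initial state. -/
def StateSpace.trajectories {m p k : ℕ} (S : StateSpace m p k) (L : ℕ) :
    Set ((Fin L → Fin m → ℝ) × (Fin L → Fin p → ℝ)) :=
  {w | ∃ x : ℕ → Fin k → ℝ, ∀ t : Fin L,
    x (t + 1) = S.A *ᵥ x t + S.B *ᵥ w.1 t ∧ w.2 t = S.C *ᵥ x t + S.D *ᵥ w.1 t}

/-- Schur stability: every complex eigenvalue lies in the open unit disk. -/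
def IsSchurStable {σ : Type*} [Fintype σ] [DecidableEq σ] (M : Matrix σ σ ℝ) : Prop :=
  ∀ z ∈ spectrum ℂ (M.map (algebraMap ℝ ℂ)), ‖z‖ < 1

/-- Stabilizability of `(A, B)`: some static state feedback makes `A - B K` Schur stable. -/
def IsStabilizable {σ ι : Type*} [Fintype σ] [DecidableEq σ] [Fintype ι]
    (A : Matrix σ σ ℝ) (B : Matrix σ ι ℝ) : Prop :=
  ∃ K : Matrix ι σ ℝ, IsSchurStable (A - B * K)

/-! ## The Moore-Penrose inverse -/

/-- The four Penrose equations. -/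
structure IsMoorePenrose {ρ κ : Type*} [Fintype ρ] [Fintype κ]
    (M : Matrix ρ κ ℝ) (X : Matrix κ ρ ℝ) : Prop where
  mul_mul_left : M * X * M = M
  mul_mul_right : X * M * X = X
  symm_left : (M * X)ᵀ = M * X
  symm_right : (X * M)ᵀ = X * M

theorem exists_isMoorePenrose {ρ κ : Type*} [Fintype ρ] [Fintype κ] (M : Matrix ρ κ ℝ) :
    ∃ X, IsMoorePenrose M X := by
  classical
  have hS : (Mᵀ * M).IsHermitian := by
    simpa using Matrix.isHermitian_conjTranspose_mul_self M
  obtain ⟨P, hPt, hPSP, hSPS, hsymm⟩ : ∃ P : Matrix κ κ ℝ, Pᵀ = P ∧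
      P * (Mᵀ * M) * P = P ∧ (Mᵀ * M) * P * (Mᵀ * M) = Mᵀ * M ∧
      (P * (Mᵀ * M))ᵀ = P * (Mᵀ * M) := by
    have hspec := hS.spectral_theorem
    set V : Matrix κ κ ℝ := (hS.eigenvectorUnitary : Matrix κ κ ℝ) with hV
    have hVV : Vᵀ * V = 1 := by
      have := Unitary.coe_star_mul_self hS.eigenvectorUnitary
      simpa [Matrix.star_eq_conjTranspose] using this
    set μ : κ → ℝ := hS.eigenvalues with hμ
    have hdec : Mᵀ * M = V * diagonal μ * Vᵀ := by
      rw [hspec]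
      simp [Unitary.conjStarAlgAut_apply, Matrix.star_eq_conjTranspose, hV, hμ]
    have key : ∀ f g : κ → ℝ, (V * diagonal f * Vᵀ) * (V * diagonal g * Vᵀ) =
        V * diagonal (fun i => f i * g i) * Vᵀ := by
      intro f g
      calc (V * diagonal f * Vᵀ) * (V * diagonal g * Vᵀ)
          = V * diagonal f * (Vᵀ * V) * diagonal g * Vᵀ := by simp only [Matrix.mul_assoc]
        _ = _ := by rw [hVV, Matrix.mul_one, Matrix.mul_assoc V, diagonal_mul_diagonal]
    refine ⟨V * diagonal (fun i => (μ i)⁻¹) * Vᵀ, ?_, ?_, ?_, ?_⟩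
    · simp [Matrix.transpose_mul, Matrix.mul_assoc]
    · rw [hdec, key, key]
      congr 3
      funext i
      by_cases h : μ i = 0 <;> simp [h]
    · rw [hdec, key, key]
      congr 3
      funext i
      by_cases h : μ i = 0 <;> simp [h]
    · rw [hdec, key]
      simp [Matrix.transpose_mul, Matrix.mul_assoc]
  refine ⟨P * Mᵀ, ?_, ?_, ?_, ?_⟩
  · have h0 : (M * (P * (Mᵀ * M)) - M)ᵀ * (M * (P * (Mᵀ * M)) - M) = 0 := by
      have h1 : (M * (P * (Mᵀ * M)) - M)ᵀ = P * (Mᵀ * M) * Mᵀ - Mᵀ := by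
        rw [transpose_sub, transpose_mul, hsymm]
      have h2 : (Mᵀ * M) * (P * (Mᵀ * M)) = Mᵀ * M := by rw [← Matrix.mul_assoc, hSPS]
      have h3 : Mᵀ * (M * (P * (Mᵀ * M)) - M) = 0 := by
        rw [Matrix.mul_sub, ← Matrix.mul_assoc Mᵀ M, h2, sub_self]
      rw [h1, Matrix.sub_mul, Matrix.mul_assoc, h3, Matrix.mul_zero, sub_zero]
    have h4 : M * (P * (Mᵀ * M)) - M = 0 := by
      rw [← Matrix.conjTranspose_mul_self_eq_zero]
      simpa using h0
    rw [sub_eq_zero] at h4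
    simpa only [Matrix.mul_assoc] using h4
  · calc P * Mᵀ * M * (P * Mᵀ) = P * (Mᵀ * M) * P * Mᵀ := by simp only [Matrix.mul_assoc]
      _ = P * Mᵀ := by rw [hPSP]
  · simp [Matrix.transpose_mul, hPt, Matrix.mul_assoc]
  · rw [Matrix.mul_assoc, hsymm]

/-- The Moore-Penrose inverse (the solution of the Penrose equations, which is unique). -/
def moorePenrose {ρ κ : Type*} [Fintype ρ] [Fintype κ] (M : Matrix ρ κ ℝ) : Matrix κ ρ ℝ :=
  (exists_isMoorePenrose M).choose

theorem moorePenrose_spec {ρ κ : Type*} [Fintype ρ] [Fintype κ] (M : Matrix ρ κ ℝ) :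
    IsMoorePenrose M (moorePenrose M) :=
  (exists_isMoorePenrose M).choose_spec

/-! ## Data matrices

A signal data matrix has `N + 1` block rows (time instants `0, …, N`) and `T` columns (experiments);
the row index `(k, a)` is the component `a` of the signal at time `k`. -/

/-- The first `N` block rows. -/
def pastData {N T : ℕ} {ι : Type*} (Z : Matrix (Fin (N + 1) × ι) (Fin T) ℝ) :
    Matrix (Fin N × ι) (Fin T) ℝ :=
  Matrix.of fun r c => Z (r.1.castSucc, r.2) c

/-- The last block row. -/
def futureData {N T : ℕ} {ι : Type*} (Z : Matrix (Fin (N + 1) × ι) (Fin T) ℝ) :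
    Matrix ι (Fin T) ℝ :=
  Matrix.of fun a c => Z (Fin.last N, a) c

/-- `H = [U_p; U_f; Y_p]`. -/
def dataMatrix {m p N T : ℕ} (U : Matrix (Fin (N + 1) × Fin m) (Fin T) ℝ)
    (Y : Matrix (Fin (N + 1) × Fin p) (Fin T) ℝ) :
    Matrix (((Fin N × Fin m) ⊕ Fin m) ⊕ (Fin N × Fin p)) (Fin T) ℝ :=
  fromRows (fromRows (pastData U) (futureData U)) (pastData Y)

/-- `H_i = [U_p; U_f; Y_{p,i}]`, where `Y_{p,i}` holds the rows of `Y_p` of the `i`-th output. -/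
def outputDataMatrix {m p N T : ℕ} (U : Matrix (Fin (N + 1) × Fin m) (Fin T) ℝ)
    (Y : Matrix (Fin (N + 1) × Fin p) (Fin T) ℝ) (i : Fin p) :
    Matrix (((Fin N × Fin m) ⊕ Fin m) ⊕ Fin N) (Fin T) ℝ :=
  fromRows (fromRows (pastData U) (futureData U)) (Matrix.of fun k c => pastData Y (k, i) c)

/-- The row vector `Y_{f,i} H_i^†`. Its entries are `b_{k,i}` (`k < N`), `b_{N,i}` and
`a_{k,i}` (`k < N`), in this order. -/
def predictor {m p N T : ℕ} (U : Matrix (Fin (N + 1) × Fin m) (Fin T) ℝ)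
    (Y : Matrix (Fin (N + 1) × Fin p) (Fin T) ℝ) (i : Fin p) :
    ((Fin N × Fin m) ⊕ Fin m) ⊕ Fin N → ℝ :=
  futureData Y i ᵥ* moorePenrose (outputDataMatrix U Y i)

/-! ## The non-minimal realization

For each output the state is `χ_i(t) = (y_i(t-N), …, y_i(t-1), u(t-N), …, u(t-1))`. -/

/-- The matrix `𝒜_i` built from the coefficients `h = (b_0, …, b_{N-1}, b_N, a_0, …, a_{N-1})`. -/
def blockA {m N : ℕ} (h : ((Fin N × Fin m) ⊕ Fin m) ⊕ Fin N → ℝ) :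
    Matrix (Fin N ⊕ (Fin N × Fin m)) (Fin N ⊕ (Fin N × Fin m)) ℝ :=
  fromBlocks
    (Matrix.of fun r c : Fin N =>
      if (r : ℕ) + 1 = N then h (Sum.inr c) else if (c : ℕ) = r + 1 then 1 else 0)
    (Matrix.of fun (r : Fin N) (c : Fin N × Fin m) =>
      if (r : ℕ) + 1 = N then h (Sum.inl (Sum.inl c)) else 0)
    0
    (Matrix.of fun r c : Fin N × Fin m =>
      if (c.1 : ℕ) = r.1 + 1 ∧ c.2 = r.2 then 1 else 0)

/-- The matrix `ℬ_i` built from the same coefficients. -/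
def blockB {m N : ℕ} (h : ((Fin N × Fin m) ⊕ Fin m) ⊕ Fin N → ℝ) :
    Matrix (Fin N ⊕ (Fin N × Fin m)) (Fin m) ℝ :=
  fromRows
    (Matrix.of fun (r : Fin N) (c : Fin m) =>
      if (r : ℕ) + 1 = N then h (Sum.inl (Sum.inr c)) else 0)
    (Matrix.of fun (r : Fin N × Fin m) (c : Fin m) =>
      if (r.1 : ℕ) + 1 = N ∧ r.2 = c then 1 else 0)

/-- `𝒜 = diag(𝒜_1, …, 𝒜_p)`. -/
def realizationA {m p N T : ℕ} (U : Matrix (Fin (N + 1) × Fin m) (Fin T) ℝ)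
    (Y : Matrix (Fin (N + 1) × Fin p) (Fin T) ℝ) :
    Matrix ((Fin N ⊕ (Fin N × Fin m)) × Fin p) ((Fin N ⊕ (Fin N × Fin m)) × Fin p) ℝ :=
  blockDiagonal fun i => blockA (predictor U Y i)

/-- `ℬ = [ℬ_1; …; ℬ_p]`. -/
def realizationB {m p N T : ℕ} (U : Matrix (Fin (N + 1) × Fin m) (Fin T) ℝ)
    (Y : Matrix (Fin (N + 1) × Fin p) (Fin T) ℝ) :
    Matrix ((Fin N ⊕ (Fin N × Fin m)) × Fin p) (Fin m) ℝ :=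
  Matrix.of fun s c => blockB (predictor U Y s.2) s.1 c

end

/-! By the Hautus test it suffices that no nonzero complex row vector `w` satisfies `w𝒜 = zw` and
`wℬ = 0` with `|z| ≥ 1`. Write `P_i = z^N - ∑ a_{k,i} z^k` and `Q_i = ∑ b_{k,i} z^k` for the
predictor of output `i`. The shift structure of `𝒜_i` makes the `i`-th block of `w` vanish as soon
as one scalar `α_i` does, namely its last output entry. It also gives `α_i P_i(z) = 0` and turns `wℬ
= 0` into `∑ α_i Q_i(z) = 0`.

The core is that `P_i` and `Q_i` have no common root with `|z| ≥ 1` (`exists_predictorNum_ne_zero`),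
and this comes from the Moore-Penrose choice. Suppose `(P_i, Q_i) = (X - z)(f, g)`. By reachability
`(f, g)` is again a relation satisfied by all trajectories (`IsAnnihilator.of_X_sub_C_mul`). Its
degree is below `N`, so its coefficients form a vector in the left kernel of `H_i`, and the
predictor is orthogonal to that kernel. Since multiplication by `X` preserves the norm of
coefficients, Pythagoras for `X(f, g) = (P_i, Q_i) + z(f, g)` forces `|z| < 1`.

For `p = 1` this gives `α = 0` at once. In general `(P_i, Q_i)` and `(D_i, N_i)` represent the same
row of the transfer matrix, so `P_i N_i = D_i Q_i`. Hence a root of `P_i` in the closed exterior of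
the disk is a root of `D_i`, and there `Q_i(z)` is a nonzero multiple of `N_i(z)`; linear
independence of the `N_i(z)` then kills all `α_i`.

That `(P_i, Q_i)` is a relation of the system at all uses the data twice: `(D_i, N_i)`, padded to
degree `N`, shows that an exact predictor exists, and the rank condition makes inputs and initial
states independent, so that exactness on the data is exactness for the system. -/

noncomputable section

/-! ### The Hautus test for stabilizability by real feedback -/

section Stabilizability

open scoped ComplexOrder

variable {σ ι : Type*} [Fintype σ]

theorem Matrix.PosSemidef.map_complex {M : Matrix σ σ ℝ} (hM : M.PosSemidef) :
    (M.map (algebraMap ℝ ℂ)).PosSemidef := by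
  classical
  open scoped MatrixOrder in
  obtain ⟨F, rfl⟩ := CStarAlgebra.nonneg_iff_eq_star_mul_self.mp hM.nonneg
  have : (star F * F).map (algebraMap ℝ ℂ) =
      (F.map (algebraMap ℝ ℂ))ᴴ * F.map (algebraMap ℝ ℂ) := by
    rw [Matrix.map_mul]
    congr 1
    ext i j
    simp [Matrix.star_apply]
  rw [this]
  exact posSemidef_conjTranspose_mul_self _

theorem Matrix.PosDef.map_complex {M : Matrix σ σ ℝ} (hM : M.PosDef) :
    (M.map (algebraMap ℝ ℂ)).PosDef := by
  classical
  rw [hM.posSemidef.map_complex.posDef_iff_isUnit]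
  have := hM.isUnit.map (algebraMap ℝ ℂ).mapMatrix
  simpa using this

/-- By homogeneity, positivity need only be tested on the unit sphere, which is compact. -/
theorem Matrix.isOpen_setOf_dotProduct_mulVec_pos :
    IsOpen {M : Matrix σ σ ℝ | ∀ x : σ → ℝ, x ≠ 0 → 0 < x ⬝ᵥ M *ᵥ x} := by
  have hset : {M : Matrix σ σ ℝ | ∀ x : σ → ℝ, x ≠ 0 → 0 < x ⬝ᵥ M *ᵥ x} =
      {M : Matrix σ σ ℝ | ∀ x ∈ Metric.sphere (0 : σ → ℝ) 1, 0 < x ⬝ᵥ M *ᵥ x} := by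
    ext M
    refine ⟨fun h x hx => h x ?_, fun h x hx => ?_⟩
    · rintro rfl
      simp at hx
    · have hx' : 0 < ‖x‖ := norm_pos_iff.mpr hx
      have := h (‖x‖⁻¹ • x) (by simp [norm_smul, hx'.ne'])
      rw [mulVec_smul, smul_dotProduct, dotProduct_smul, smul_eq_mul, smul_eq_mul] at this
      have h2 : 0 < ‖x‖⁻¹ := inv_pos.mpr hx'
      exact pos_of_mul_pos_right (pos_of_mul_pos_right this h2.le) h2.le
  rw [hset, isOpen_iff_mem_nhds]
  intro M hM
  refine (isCompact_sphere (0 : σ → ℝ) 1).eventually_forall_of_forall_eventually fun x hx => ?_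
  have hc : Continuous fun q : Matrix σ σ ℝ × (σ → ℝ) => q.2 ⬝ᵥ q.1 *ᵥ q.2 := by fun_prop
  exact hc.continuousAt.eventually (lt_mem_nhds (hM x hx))

/-- Theorem of the alternative for the stabilization inequality `X + μ B Bᵀ ≻ A X Aᵀ`. -/
theorem exists_posSemidef_of_forall_not_posDef [Fintype ι] (A : Matrix σ σ ℝ) (B : Matrix σ ι ℝ)
    (h : ∀ X : Matrix σ σ ℝ, X.PosSemidef → ∀ μ : ℝ, 0 ≤ μ →
      ¬ (X - A * X * Aᵀ + μ • (B * Bᵀ)).PosDef) :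
    ∃ Z : Matrix σ σ ℝ, Z.PosSemidef ∧ Z ≠ 0 ∧ Z * B = 0 ∧ (Aᵀ * Z * A - Z).PosSemidef := by
  classical
  -- Symmetry is not demanded, since the separation theorem needs a set that is open in the space of
  -- all matrices.
  let s : Set (Matrix σ σ ℝ) := {M | ∀ x : σ → ℝ, x ≠ 0 → 0 < x ⬝ᵥ M *ᵥ x}
  let L : Matrix σ σ ℝ × ℝ →ₗ[ℝ] Matrix σ σ ℝ :=
    { toFun := fun q => q.1 - A * q.1 * Aᵀ + q.2 • (B * Bᵀ)
      map_add' := by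
        intro q r
        simp only [Prod.fst_add, Prod.snd_add, Matrix.mul_add, Matrix.add_mul, add_smul]
        abel
      map_smul' := by
        intro c q
        simp [smul_sub, mul_smul] }
  have hL : ∀ X μ, L (X, μ) = X - A * X * Aᵀ + μ • (B * Bᵀ) := fun _ _ => rfl
  let d : Set (Matrix σ σ ℝ × ℝ) := {q | q.1.PosSemidef ∧ 0 ≤ q.2}
  have hs : Convex ℝ s := by
    intro M hM M' hM' a b ha hb hab x hx
    rw [add_mulVec, dotProduct_add, smul_mulVec, smul_mulVec, dotProduct_smul, dotProduct_smul,
      smul_eq_mul, smul_eq_mul]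
    have h1 := hM x hx
    have h2 := hM' x hx
    rcases ha.eq_or_lt with rfl | ha
    · have : b = 1 := by linarith
      subst this
      linarith
    · nlinarith [mul_pos ha h1, mul_nonneg hb h2.le]
  have hd : Convex ℝ d := by
    rintro ⟨X, μ⟩ ⟨hX, hμ⟩ ⟨X', μ'⟩ ⟨hX', hμ'⟩ a b ha hb hab
    exact ⟨(hX.smul ha).add (hX'.smul hb), add_nonneg (mul_nonneg ha hμ) (mul_nonneg hb hμ')⟩
  have hdisj : Disjoint s (L '' d) := by
    rw [Set.disjoint_left]
    rintro _ hM ⟨⟨X, μ⟩, ⟨hX, hμ⟩, rfl⟩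
    refine h X hX μ hμ (PosDef.of_dotProduct_mulVec_pos ?_ fun {x} hx => hM x hx)
    have hXt : Xᵀ = X := by simpa [IsHermitian] using hX.isHermitian
    simp [IsHermitian, Matrix.transpose_mul, hXt, Matrix.mul_assoc]
  obtain ⟨f, u, hfs, hfd⟩ := geometric_hahn_banach_open hs
    isOpen_setOf_dotProduct_mulVec_pos (hd.linear_image L) hdisj
  have hu : u ≤ 0 := by
    simpa using hfd 0 ⟨0, ⟨PosSemidef.zero, le_rfl⟩, map_zero L⟩
  have hf_neg : ∀ M ∈ s, f M < 0 := fun M hM => (hfs M hM).trans_le hu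
  have hf_cone : ∀ q ∈ d, 0 ≤ f (L q) := by
    intro q hq
    by_contra hneg
    push Not at hneg
    -- The scaling makes the value of `f` equal to `u - 1`, below the bound `u`: a functional
    -- bounded below on a cone is nonnegative there.
    have hmem : ((u - 1) / f (L q)) • q ∈ d := by
      have h0 : 0 ≤ (u - 1) / f (L q) := div_nonneg_of_nonpos (by linarith) hneg.le
      exact ⟨hq.1.smul h0, mul_nonneg h0 hq.2⟩
    have h1 := hfd _ ⟨_, hmem, rfl⟩
    rw [map_smul, map_smul, smul_eq_mul, div_mul_cancel₀ _ hneg.ne] at h1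
    linarith
  have hone : (1 : Matrix σ σ ℝ) ∈ s := by
    intro x hx
    have := dotProduct_star_self_pos_iff.mpr hx
    simpa using this
  have hrank : ∀ x : σ → ℝ, (vecMulVec x x).PosSemidef := fun x => by
    simpa using posSemidef_vecMulVec_self_star x
  have hf_rank : ∀ x : σ → ℝ, f (vecMulVec x x) ≤ 0 := by
    intro x
    by_contra hpos
    push Not at hpos
    -- The multiple of the identity is chosen so that `f` vanishes at this matrix, although `f` is
    -- negative on `s`.
    have hmem : vecMulVec x x + (f (vecMulVec x x) / (-f 1)) • (1 : Matrix σ σ ℝ) ∈ s := by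
      intro y hy
      rw [add_mulVec, dotProduct_add, smul_mulVec, dotProduct_smul, smul_eq_mul]
      have h1 : 0 ≤ y ⬝ᵥ vecMulVec x x *ᵥ y := by
        simpa using (hrank x).dotProduct_mulVec_nonneg y
      have h2 := mul_pos (div_pos hpos (neg_pos.mpr (hf_neg 1 hone))) (hone y hy)
      linarith
    have h3 := hf_neg _ hmem
    rw [map_add, map_smul, smul_eq_mul, div_mul_eq_mul_div, div_neg,
      mul_div_cancel_right₀ _ (hf_neg 1 hone).ne] at h3
    linarith
  -- The functional `-f`, symmetrized and written as a matrix; the factor 2 in `hZ` comes from the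
  -- missing one half.
  let Z : Matrix σ σ ℝ := Matrix.of fun i j => -(f (Matrix.single i j 1) + f (Matrix.single j i 1))
  have hf_vec : ∀ x y : σ → ℝ, f (vecMulVec x y) =
      ∑ i, ∑ j, x i * y j * f (Matrix.single i j 1) := by
    intro x y
    conv_lhs => rw [matrix_eq_sum_single (vecMulVec x y)]
    simp only [map_sum]
    refine Finset.sum_congr rfl fun i _ => Finset.sum_congr rfl fun j _ => ?_
    rw [vecMulVec_apply, ← smul_eq_mul (x i * y j), ← map_smul, Matrix.smul_single, smul_eq_mul,
      mul_one]
  have hZ : ∀ x : σ → ℝ, x ⬝ᵥ Z *ᵥ x = -2 * f (vecMulVec x x) := by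
    intro x
    have h1 : x ⬝ᵥ Z *ᵥ x = -(∑ i, ∑ j, x i * x j * f (Matrix.single i j 1)) -
        ∑ i, ∑ j, x i * x j * f (Matrix.single j i 1) := by
      simp only [dotProduct, mulVec, Z, Matrix.of_apply, Finset.mul_sum, ← Finset.sum_neg_distrib,
        ← Finset.sum_sub_distrib]
      refine Finset.sum_congr rfl fun i _ => Finset.sum_congr rfl fun j _ => ?_
      ring
    rw [h1, Finset.sum_comm (f := fun i j => x i * x j * f (Matrix.single j i 1)), hf_vec]
    simp only [mul_comm (x _) (x _)]
    ring
  have hZsymm : Z.IsHermitian := by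
    ext i j
    simp [Z, add_comm]
  have hZpos : Z.PosSemidef := by
    refine PosSemidef.of_dotProduct_mulVec_nonneg hZsymm fun x => ?_
    have := hf_rank x
    rw [star_trivial, hZ]
    linarith
  refine ⟨Z, hZpos, ?_, ?_, ?_⟩
  · intro hZ0
    have h1 : f 1 = 0 := by
      have h2 : (1 : Matrix σ σ ℝ) = ∑ i, vecMulVec (Pi.single i 1) (Pi.single i 1) := by
        rw [matrix_eq_sum_single (1 : Matrix σ σ ℝ)]
        refine Finset.sum_congr rfl fun i _ => ?_
        rw [Finset.sum_eq_single i (by intro j _ hj; simp [Matrix.one_apply_ne hj.symm])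
          (by simp)]
        ext a b
        simp [Matrix.single_apply, vecMulVec_apply, Pi.single_apply]
        grind
      rw [h2, map_sum]
      refine Finset.sum_eq_zero fun i _ => ?_
      have := hZ (Pi.single i 1)
      rw [hZ0] at this
      simp only [zero_mulVec, dotProduct_zero] at this
      linarith
    exact (hf_neg 1 hone).ne h1
  · have hBB : B * Bᵀ = ∑ j, vecMulVec (B.col j) (B.col j) := by
      ext a b
      simp [Matrix.mul_apply, Matrix.sum_apply, vecMulVec_apply]
    have h1 := hf_cone (0, 1) ⟨PosSemidef.zero, zero_le_one⟩
    rw [hL, one_smul, hBB] at h1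
    simp only [Matrix.mul_zero, Matrix.zero_mul, sub_zero, zero_add, map_sum] at h1
    have h2 := (Finset.sum_eq_zero_iff_of_nonpos fun j _ => hf_rank (B.col j)).mp
      (le_antisymm (Finset.sum_nonpos fun j _ => hf_rank (B.col j)) h1)
    ext i j
    have h3 := (hZpos.dotProduct_mulVec_zero_iff (B.col j)).mp (by
      rw [star_trivial, hZ, h2 j (Finset.mem_univ j), mul_zero])
    exact congrFun h3 i
  · refine PosSemidef.of_dotProduct_mulVec_nonneg ?_ fun x => ?_
    · have hZt : Zᵀ = Z := by simpa [IsHermitian] using hZsymm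
      simp [IsHermitian, Matrix.transpose_mul, hZt, Matrix.mul_assoc]
    · have h1 := hf_cone (vecMulVec x x, 0) ⟨hrank x, le_rfl⟩
      rw [hL, zero_smul, add_zero] at h1
      have h2 : A * vecMulVec x x * Aᵀ = vecMulVec (A *ᵥ x) (A *ᵥ x) := by
        rw [mul_vecMulVec, vecMulVec_mul, vecMul_transpose]
      rw [h2, map_sub] at h1
      have h3 : x ⬝ᵥ (Aᵀ * Z * A) *ᵥ x = (A *ᵥ x) ⬝ᵥ Z *ᵥ (A *ᵥ x) := by
        rw [← mulVec_mulVec, ← mulVec_mulVec, dotProduct_mulVec, vecMul_transpose]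
      rw [star_trivial, sub_mulVec, dotProduct_sub, h3, hZ, hZ]
      linarith

/-- `A` does not decrease the seminorm of `Z`, so `ker (ZA) ⊆ ker Z`. Since `rank (ZA) ≤ rank Z`,
the kernels agree, and `ker Z` is `A`-invariant and contains the columns of `B`. On the nonzero
quotient by `ker Z` the form is definite and `A` is expanding, so every eigenvalue there has modulus
at least 1. A left eigenvector on the quotient pulls back to the required `w`. -/
theorem exists_left_eigenvector_of_posSemidef (A : Matrix σ σ ℝ) (B : Matrix σ ι ℝ)
    {Z : Matrix σ σ ℝ} (hZ : Z.PosSemidef) (hZ0 : Z ≠ 0) (hZB : Z * B = 0)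
    (hAZ : (Aᵀ * Z * A - Z).PosSemidef) :
    ∃ (z : ℂ) (w : σ → ℂ), 1 ≤ ‖z‖ ∧ w ≠ 0 ∧ w ᵥ* A.map (algebraMap ℝ ℂ) = z • w ∧
      w ᵥ* B.map (algebraMap ℝ ℂ) = 0 := by
  classical
  set A' := A.map (algebraMap ℝ ℂ) with hA'
  set B' := B.map (algebraMap ℝ ℂ) with hB'
  set Z' := Z.map (algebraMap ℝ ℂ) with hZ'
  have hAH : A'ᴴ = Aᵀ.map (algebraMap ℝ ℂ) := by
    ext i j
    simp [hA']
  have hZp : Z'.PosSemidef := hZ.map_complex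
  have hineq : ∀ x : σ → ℂ, star x ⬝ᵥ Z' *ᵥ x ≤ star (A' *ᵥ x) ⬝ᵥ Z' *ᵥ (A' *ᵥ x) := by
    intro x
    have h1 := hAZ.map_complex.dotProduct_mulVec_nonneg x
    rw [Matrix.map_sub _ (map_sub _), Matrix.map_mul, Matrix.map_mul, ← hAH, sub_mulVec,
      dotProduct_sub, sub_nonneg, ← mulVec_mulVec, ← mulVec_mulVec,
      dotProduct_mulVec (star x) A'ᴴ, ← star_mulVec] at h1
    exact h1
  have hker_le : LinearMap.ker (Z' * A').mulVecLin ≤ LinearMap.ker Z'.mulVecLin := by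
    intro x hx
    rw [LinearMap.mem_ker, mulVecLin_apply, ← mulVec_mulVec] at hx
    have h1 := hineq x
    rw [hx, dotProduct_zero] at h1
    rw [LinearMap.mem_ker, mulVecLin_apply, ← hZp.dotProduct_mulVec_zero_iff]
    exact le_antisymm h1 (hZp.dotProduct_mulVec_nonneg x)
  have hker : LinearMap.ker Z'.mulVecLin = LinearMap.ker (Z' * A').mulVecLin := by
    refine (Submodule.eq_of_le_of_finrank_le hker_le ?_).symm
    have h1 := LinearMap.finrank_range_add_finrank_ker Z'.mulVecLin
    have h2 := LinearMap.finrank_range_add_finrank_ker (Z' * A').mulVecLin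
    have h3 : Module.finrank ℂ (LinearMap.range (Z' * A').mulVecLin) ≤
        Module.finrank ℂ (LinearMap.range Z'.mulVecLin) := Matrix.rank_mul_le_left Z' A'
    omega
  set W := LinearMap.ker Z'.mulVecLin with hW
  have hinv : W ≤ W.comap A'.mulVecLin := by
    intro x hx
    rw [hker] at hx
    simpa [hW, mulVec_mulVec] using hx
  have hWtop : W ≠ ⊤ := by
    intro htop
    apply hZ0
    have h1 : Z' = 0 := by
      have : Z'.mulVecLin = 0 := LinearMap.ker_eq_top.mp htop
      ext i j
      have := congrFun (LinearMap.congr_fun this (Pi.single j 1)) i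
      simpa using this
    ext i j
    have := congrFun (congrFun h1 i) j
    simpa [hZ'] using this
  have : Nontrivial ((σ → ℂ) ⧸ W) := Submodule.Quotient.nontrivial_iff.mpr hWtop
  set T : Module.End ℂ ((σ → ℂ) ⧸ W) := W.mapQ W A'.mulVecLin hinv with hT
  obtain ⟨z, hz⟩ := Module.End.exists_eigenvalue T
  obtain ⟨v, hv⟩ := hz.exists_hasEigenvector
  obtain ⟨x, rfl⟩ := W.mkQ_surjective v
  have hx0 : Z' *ᵥ x ≠ 0 := by
    intro hx
    apply hv.2
    simpa [hW] using hx
  have hxe : Z' *ᵥ (A' *ᵥ x) = z • (Z' *ᵥ x) := by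
    have h1 := hv.apply_eq_smul
    rw [hT, Submodule.mkQ_apply, Submodule.mapQ_apply, ← Submodule.Quotient.mk_smul,
      Submodule.Quotient.eq] at h1
    simp only [hW, LinearMap.mem_ker, mulVecLin_apply, mulVec_sub, mulVec_smul] at h1
    exact sub_eq_zero.mp h1
  have hznorm : 1 ≤ ‖z‖ := by
    have h1 := hineq x
    have hH : star (A' *ᵥ x) ⬝ᵥ Z' *ᵥ x = star z * (star x ⬝ᵥ Z' *ᵥ x) := by
      rw [dotProduct_mulVec, ← hZp.isHermitian.eq, ← star_mulVec, hxe, star_smul, smul_dotProduct,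
        star_mulVec, dotProduct_mulVec, smul_eq_mul]
    rw [hxe, dotProduct_smul, hH, smul_eq_mul, ← mul_assoc] at h1
    have hpos : 0 < star x ⬝ᵥ Z' *ᵥ x :=
      lt_of_le_of_ne (hZp.dotProduct_mulVec_nonneg x)
        fun h => hx0 ((hZp.dotProduct_mulVec_zero_iff x).mp h.symm)
    have h2 : (1 : ℂ) ≤ z * star z := by
      by_contra hcon
      have hzz : z * star z = ((‖z‖ ^ 2 : ℝ) : ℂ) := by
        simpa using Complex.mul_conj' z
      obtain ⟨r, hr⟩ : ∃ r : ℝ, (r : ℂ) = star x ⬝ᵥ Z' *ᵥ x :=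
        ⟨_, (Complex.eq_re_of_ofReal_le hpos.le).symm⟩
      rw [← hr] at hpos h1
      rw [hzz] at h1 hcon
      norm_cast at h1 hpos hcon
      nlinarith
    rw [show z * star z = ((‖z‖ ^ 2 : ℝ) : ℂ) by simpa using Complex.mul_conj' z] at h2
    norm_cast at h2
    nlinarith [norm_nonneg z]
  -- Not injective, hence not surjective in finite dimension; a functional vanishing on the range is
  -- a left eigenvector of `T`.
  have hrange : LinearMap.range (T - z • 1) < ⊤ := by
    rw [lt_top_iff_ne_top, Ne, LinearMap.range_eq_top, ← LinearMap.injective_iff_surjective,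
      ← LinearMap.ker_eq_bot, ← Module.End.eigenspace_def]
    exact Module.End.hasEigenvalue_iff.mp hz
  obtain ⟨ψ, hψ0, hψ⟩ := Submodule.exists_le_ker_of_lt_top _ hrange
  set w : σ → ℂ := fun i => ψ (W.mkQ (Pi.single i 1)) with hw
  have hwdot : ∀ y : σ → ℂ, w ⬝ᵥ y = ψ (W.mkQ y) := by
    intro y
    conv_rhs => rw [pi_eq_sum_univ' y]
    simp [hw, dotProduct, mul_comm]
  refine ⟨z, w, hznorm, ?_, ?_, ?_⟩
  · intro hw0
    apply hψ0
    ext y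
    have := hwdot (Pi.single y 1)
    rw [hw0, zero_dotProduct] at this
    simpa using this.symm
  · ext j
    have h1 : ψ ((T - z • 1) (W.mkQ (Pi.single j 1))) = 0 :=
      hψ ⟨_, rfl⟩
    have h2 := hwdot (A' *ᵥ Pi.single j 1)
    rw [LinearMap.sub_apply, map_sub, sub_eq_zero, hT, Submodule.mkQ_apply, Submodule.mapQ_apply,
      mulVecLin_apply, ← Submodule.mkQ_apply, ← h2, LinearMap.smul_apply, Module.End.one_apply,
      map_smul, dotProduct_mulVec, dotProduct_single_one] at h1
    simpa [hw] using h1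
  · ext j
    have h1 := hwdot (B'.col j)
    have h2 : W.mkQ (B'.col j) = 0 := by
      have : Z' * B' = 0 := by rw [hZ', hB', ← Matrix.map_mul, hZB]; simp
      simp only [Submodule.mkQ_apply, Submodule.Quotient.mk_eq_zero, hW, LinearMap.mem_ker,
        mulVecLin_apply]
      ext i
      exact congrFun (congrFun this i) j
    rw [h2, map_zero] at h1
    exact h1

/-- With `S = X + μBBᵀ` the feedback `μBᵀS⁻¹A` yields the closed loop `XS⁻¹A`. For a left
eigenvector `v*` put `g = S⁻¹Xv`, so that `g*A = zv*`. If `g ≠ 0`, then `|z|² v*Xv = g*AXAᵀg < g*Sg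
≤ v*Xv`, so `|z| < 1`. -/
theorem isStabilizable_of_posDef [DecidableEq σ] [Fintype ι] (A : Matrix σ σ ℝ) (B : Matrix σ ι ℝ)
    {X : Matrix σ σ ℝ} (hX : X.PosSemidef) {μ : ℝ} (hμ : 0 ≤ μ)
    (h : (X - A * X * Aᵀ + μ • (B * Bᵀ)).PosDef) : IsStabilizable A B := by
  set S := X + μ • (B * Bᵀ) with hS
  have hAX : (A * X * Aᵀ).PosSemidef := by
    simpa using hX.mul_mul_conjTranspose_same A
  have hBB : (μ • (B * Bᵀ)).PosSemidef := by
    simpa using (posSemidef_self_mul_conjTranspose B).smul hμ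
  have hSA : (S - A * X * Aᵀ).PosDef := by
    rw [hS]
    convert h using 1
    abel
  have hSpos : S.PosDef := by
    have := hSA.add_posSemidef hAX
    rwa [sub_add_cancel] at this
  have hSX : (S - X).PosSemidef := by rwa [hS, add_sub_cancel_left]
  have hSdet : IsUnit S.det := (Matrix.isUnit_iff_isUnit_det S).mp hSpos.isUnit
  refine ⟨μ • (Bᵀ * S⁻¹ * A), fun z hz => ?_⟩
  have hcl : A - B * (μ • (Bᵀ * S⁻¹ * A)) = X * S⁻¹ * A := by
    have h1 : X = S - μ • (B * Bᵀ) := by rw [hS, add_sub_cancel_right]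
    conv_rhs => rw [h1]
    rw [Matrix.sub_mul, Matrix.sub_mul, Matrix.mul_nonsing_inv _ hSdet, Matrix.one_mul,
      Matrix.mul_smul]
    simp only [Matrix.smul_mul, Matrix.mul_assoc]
  rw [hcl] at hz
  set c : ℝ →+* ℂ := algebraMap ℝ ℂ with hc
  have hconj : ∀ {κ κ' : Type _} (M : Matrix κ κ' ℝ), (M.map c)ᴴ = Mᵀ.map c := by
    intro κ κ' M
    ext i j
    simp [hc]
  obtain ⟨v, hv0, hv⟩ : ∃ v : σ → ℂ, v ≠ 0 ∧
      star v ᵥ* (X * S⁻¹ * A).map c = z • star v := by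
    rw [spectrum.mem_iff, Matrix.isUnit_iff_isUnit_det, isUnit_iff_ne_zero, not_not] at hz
    obtain ⟨v, hv0, hv⟩ := Matrix.exists_vecMul_eq_zero_iff.mpr hz
    refine ⟨star v, by simpa using hv0, ?_⟩
    rw [vecMul_sub, sub_eq_zero] at hv
    rw [star_star, ← hv, Matrix.algebraMap_eq_diagonal]
    ext i
    simp [vecMul_diagonal, mul_comm]
  set g : σ → ℂ := (S⁻¹.map c * X.map c) *ᵥ v with hg
  have hXH : (X.map c)ᴴ = X.map c := hX.map_complex.isHermitian
  have hSH : (S.map c)ᴴ = S.map c := hSpos.map_complex.isHermitian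
  have hSiH : (S⁻¹.map c)ᴴ = S⁻¹.map c := hSpos.inv.map_complex.isHermitian
  have hSg : S.map c *ᵥ g = X.map c *ᵥ v := by
    rw [hg, mulVec_mulVec, ← Matrix.mul_assoc, ← Matrix.map_mul,
      Matrix.mul_nonsing_inv _ hSdet]
    simp
  have hgA : star g ᵥ* A.map c = z • star v := by
    rw [← hv, hg, star_mulVec, conjTranspose_mul, hXH, hSiH, Matrix.map_mul, Matrix.map_mul,
      vecMul_vecMul]
  have hgAX : star g ⬝ᵥ (A * X * Aᵀ).map c *ᵥ g =
      (z * star z) * (star v ⬝ᵥ X.map c *ᵥ v) := by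
    rw [Matrix.map_mul, Matrix.map_mul, ← mulVec_mulVec, ← mulVec_mulVec, dotProduct_mulVec, hgA,
      ← hconj]
    have h1 : (A.map c)ᴴ *ᵥ g = star z • v := by
      have := congrArg star hgA
      rwa [star_vecMul, star_star, star_smul, star_star] at this
    rw [h1, mulVec_smul, smul_dotProduct, dotProduct_smul, smul_eq_mul, smul_eq_mul, mul_assoc]
  have hvX := hX.map_complex.dotProduct_mulVec_nonneg v
  -- This is the sum of `(v - g)*X(v - g) ≥ 0` and `g*(S - X)g ≥ 0`, using `Sg = Xv`.
  have hcs : star g ⬝ᵥ S.map c *ᵥ g ≤ star v ⬝ᵥ X.map c *ᵥ v := by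
    have h1 := hX.map_complex.dotProduct_mulVec_nonneg (v - g)
    have h2 := hSX.map_complex.dotProduct_mulVec_nonneg g
    have h3 : star g ⬝ᵥ X.map c *ᵥ v = star g ⬝ᵥ S.map c *ᵥ g := by rw [hSg]
    have h4 : star v ⬝ᵥ X.map c *ᵥ g = star g ⬝ᵥ S.map c *ᵥ g := by
      have h5 : star v ᵥ* X.map c = star g ᵥ* S.map c := by
        rw [← hXH, ← hSH, ← star_mulVec, ← star_mulVec, hSg]
      rw [dotProduct_mulVec, h5, ← dotProduct_mulVec]
    rw [Matrix.map_sub _ (map_sub _), sub_mulVec, dotProduct_sub] at h2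
    rw [star_sub, mulVec_sub, sub_dotProduct, dotProduct_sub, dotProduct_sub] at h1
    change 0 ≤ star v ⬝ᵥ X.map c *ᵥ v - star v ⬝ᵥ X.map c *ᵥ g -
      (star g ⬝ᵥ X.map c *ᵥ v - star g ⬝ᵥ X.map c *ᵥ g) at h1
    change 0 ≤ star g ⬝ᵥ S.map c *ᵥ g - star g ⬝ᵥ X.map c *ᵥ g at h2
    rw [h3, h4] at h1
    have h5 := add_nonneg h1 h2
    rw [← sub_nonneg]
    convert h5 using 1
    ring
  by_cases hg0 : g = 0
  · rw [hg0, star_zero, zero_vecMul, eq_comm, smul_eq_zero] at hgA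
    rcases hgA with rfl | h1
    · simp
    · exact absurd (by simpa using h1) hv0
  · have h1 := hSA.map_complex.dotProduct_mulVec_pos hg0
    rw [Matrix.map_sub _ (map_sub _), sub_mulVec, dotProduct_sub, sub_pos] at h1
    have h2 := h1.trans_le hcs
    change star g ⬝ᵥ (A * X * Aᵀ).map c *ᵥ g < _ at h2
    rw [hgAX] at h2
    change 0 ≤ star v ⬝ᵥ X.map c *ᵥ v at hvX
    obtain ⟨r, hr⟩ : ∃ r : ℝ, (r : ℂ) = star v ⬝ᵥ X.map c *ᵥ v :=
      ⟨_, (Complex.eq_re_of_ofReal_le hvX).symm⟩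
    rw [← hr] at hvX h2
    rw [show z * star z = ((‖z‖ ^ 2 : ℝ) : ℂ) by simpa using Complex.mul_conj' z] at h2
    norm_cast at h2 hvX
    by_contra hcon
    push Not at hcon
    exact h2.not_ge (le_mul_of_one_le_left hvX (one_le_pow₀ hcon))

/-- The Hautus test: a real pair without uncontrollable modes on or outside the unit circle is
stabilized by a real state feedback. -/
theorem isStabilizable_of_hautus [DecidableEq σ] [Fintype ι] (A : Matrix σ σ ℝ) (B : Matrix σ ι ℝ)
    (h : ∀ (z : ℂ) (w : σ → ℂ), 1 ≤ ‖z‖ → w ᵥ* A.map (algebraMap ℝ ℂ) = z • w →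
      w ᵥ* B.map (algebraMap ℝ ℂ) = 0 → w = 0) : IsStabilizable A B := by
  by_contra hcon
  obtain ⟨Z, hZ, hZ0, hZB, hAZ⟩ := exists_posSemidef_of_forall_not_posDef A B
    fun X hX μ hμ hpos => hcon (isStabilizable_of_posDef A B hX hμ hpos)
  obtain ⟨z, w, hz, hw0, hwA, hwB⟩ := exists_left_eigenvector_of_posSemidef A B hZ hZ0 hZB hAZ
  exact hw0 (h z w hz hwA hwB)

end Stabilizability

/-! ### Polynomial parts of products with a transfer function -/

section PolynomialPart

variable {K σ ι : Type*} [Field K] [Fintype σ] [DecidableEq σ]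

/-- The Markov parameters `d, c b, c A b, c A² b, …`. -/
def markov (A : Matrix σ σ K) (c b : σ → K) (d : K) : ℕ → K
  | 0 => d
  | k + 1 => c ⬝ᵥ (A ^ k *ᵥ b)

/-- The polynomial part of `z ^ k ∑ M_j z^{-j}`. -/
def powPolyPart (M : ℕ → K) (k : ℕ) : K[X] := ∑ j ∈ Finset.range (k + 1), C (M (k - j)) * X ^ j

theorem coeff_powPolyPart (M : ℕ → K) (k j : ℕ) :
    (powPolyPart M k).coeff j = if j ≤ k then M (k - j) else 0 := by
  simp [powPolyPart, Polynomial.finsetSum_coeff, Polynomial.coeff_C_mul, Polynomial.coeff_X_pow]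

theorem powPolyPart_succ (M : ℕ → K) (k : ℕ) :
    powPolyPart M (k + 1) = X * powPolyPart M k + C (M (k + 1)) := by
  rw [powPolyPart, Finset.sum_range_succ', powPolyPart, Finset.mul_sum]
  simp only [Nat.add_sub_add_right, pow_succ, Nat.sub_zero, pow_zero, mul_one]
  congr 1
  refine Finset.sum_congr rfl fun j _ => ?_
  ring

/-- The polynomial part of `a(z) (c (zI - A)⁻¹ b + d)`. -/
def numer (A : Matrix σ σ K) (c b : σ → K) (d : K) : K[X] →ₗ[K] K[X] :=
  Polynomial.lsum fun k => LinearMap.toSpanSingleton K K[X] (powPolyPart (markov A c b d) k)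

variable (A : Matrix σ σ K) (c b : σ → K) (d : K)

theorem numer_eq_sum (a : K[X]) :
    numer A c b d a = a.sum fun k x => x • powPolyPart (markov A c b d) k := rfl

theorem numer_monomial (k : ℕ) (x : K) :
    numer A c b d (monomial k x) = x • powPolyPart (markov A c b d) k := by
  rw [numer_eq_sum, Polynomial.sum_monomial_index]
  simp

theorem numer_one : numer A c b d 1 = C d := by
  rw [← Polynomial.monomial_zero_one, numer_monomial]
  simp [powPolyPart, markov]

/-- Multiplication by `X` moves the coefficient of `z⁻¹` in `a(z)G(z)`, which is `c a(A) b`, into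
the polynomial part. -/
theorem numer_X_mul (a : K[X]) :
    numer A c b d (X * a) = X * numer A c b d a + C (c ᵥ* aeval A a ⬝ᵥ b) := by
  induction a using Polynomial.induction_on' with
  | add p q hp hq =>
    rw [mul_add, map_add, hp, hq, map_add, map_add, vecMul_add, add_dotProduct, map_add]
    ring
  | monomial k x =>
    rw [X_mul_monomial, numer_monomial, numer_monomial, powPolyPart_succ, aeval_monomial,
      ← Algebra.smul_def, vecMul_smul, smul_dotProduct, ← dotProduct_mulVec, smul_add, markov,
      mul_smul_comm, smul_C]

theorem coeff_numer (a : K[X]) (j : ℕ) : (numer A c b d a).coeff j =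
    a.sum fun k x => x * if j ≤ k then markov A c b d (k - j) else 0 := by
  rw [numer_eq_sum, Polynomial.sum_def, Polynomial.finsetSum_coeff, Polynomial.sum_def]
  simp [coeff_powPolyPart]

theorem degree_numer_lt {a : K[X]} (ha : a ≠ 0) : (numer A c b 0 a).degree < a.degree := by
  rw [degree_eq_natDegree ha, degree_lt_iff_coeff_zero]
  intro j hj
  rw [coeff_numer, Polynomial.sum_def]
  refine Finset.sum_eq_zero fun k hk => ?_
  have hk' : k ≤ a.natDegree := le_natDegree_of_mem_supp k hk
  split_ifs with h
  · have : k - j = 0 := by omega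
    rw [this, markov, mul_zero]
  · rw [mul_zero]

theorem natDegree_numer_le (a : K[X]) : (numer A c b d a).natDegree ≤ a.natDegree := by
  rw [natDegree_le_iff_coeff_eq_zero]
  intro j hj
  rw [coeff_numer, Polynomial.sum_def]
  refine Finset.sum_eq_zero fun k hk => ?_
  have hk' : k ≤ a.natDegree := le_natDegree_of_mem_supp k hk
  rw [if_neg (by omega), mul_zero]

end PolynomialPart

/-! ### Polynomial relations satisfied by the trajectories -/

section Annihilator

variable {K σ ι : Type*} [Field K] [Fintype σ] [DecidableEq σ]

/-- `a(z) y = q(z) u` holds along all trajectories of `(A, B, c, d)`. -/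
def IsAnnihilator (A : Matrix σ σ K) (B : Matrix σ ι K) (c : σ → K) (d : ι → K) (a : K[X])
    (q : ι → K[X]) : Prop :=
  c ᵥ* aeval A a = 0 ∧ ∀ l, numer A c (B.col l) (d l) a = q l

/-- Only the zero row vector is orthogonal to the reachable space. -/
def IsReachable (A : Matrix σ σ K) (B : Matrix σ ι K) : Prop :=
  ∀ w : σ → K, (∀ k : ℕ, w ᵥ* (A ^ k * B) = 0) → w = 0

variable {A : Matrix σ σ K} {B : Matrix σ ι K} {c : σ → K} {d : ι → K} {a a' : K[X]}
  {q q' : ι → K[X]}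

theorem IsAnnihilator.mul_left (h : IsAnnihilator A B c d a q) (f : K[X]) :
    IsAnnihilator A B c d (f * a) fun l => f * q l := by
  have hA : ∀ g : K[X], c ᵥ* aeval A (g * a) = 0 := by
    intro g
    rw [mul_comm, map_mul, ← vecMul_vecMul, h.1, zero_vecMul]
  refine ⟨hA f, fun l => ?_⟩
  beta_reduce
  induction f using Polynomial.induction_on with
  | C r => rw [← smul_eq_C_mul, ← smul_eq_C_mul, map_smul, h.2]
  | add p r hp hr => rw [add_mul, map_add, hp, hr, add_mul]
  | monomial k r hk =>
    rw [show C r * X ^ (k + 1) * a = X * (C r * X ^ k * a) by ring, numer_X_mul, hk, hA,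
      zero_dotProduct, map_zero, add_zero]
    ring

/-- Both sides are the polynomial part of the transfer function times `a * a'`. -/
theorem IsAnnihilator.cross (h : IsAnnihilator A B c d a q) (h' : IsAnnihilator A B c d a' q')
    (l : ι) : a * q' l = a' * q l := by
  exact ((h'.mul_left a).2 l).symm.trans (by rw [mul_comm, (h.mul_left a').2 l])

/-- A common factor can be cancelled because the defect `w = c a(A)` is a left eigenvector of `A` at
`z`, while `(X - z)(q_l - numer a)` is the constant `w ⬝ B_l`. Evaluation at `z` shows `wB = 0`, so
`w` is orthogonal to the reachable space. -/
theorem IsAnnihilator.of_X_sub_C_mul (hAB : IsReachable A B) {z : K}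
    (h : IsAnnihilator A B c d ((X - C z) * a) fun l => (X - C z) * q l) :
    IsAnnihilator A B c d a q := by
  set w := c ᵥ* aeval A a with hw
  have hwA : w ᵥ* A = z • w := by
    have h1 := h.1
    rw [mul_comm, map_mul, ← vecMul_vecMul, map_sub, aeval_X, aeval_C, vecMul_sub, sub_eq_zero,
      Algebra.algebraMap_eq_smul_one, vecMul_smul, vecMul_one] at h1
    exact h1
  have hq : ∀ l, (X - C z) * (q l - numer A c (B.col l) (d l) a) = C (w ⬝ᵥ B.col l) := by
    intro l
    have h1 := h.2 l
    rw [sub_mul, map_sub, numer_X_mul, ← smul_eq_C_mul, map_smul, smul_eq_C_mul] at h1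
    linear_combination -h1
  have hz : ∀ l, w ⬝ᵥ B.col l = 0 := by
    intro l
    have h1 := congrArg (eval z) (hq l)
    simpa using h1.symm
  have hwpow : ∀ k, w ᵥ* A ^ k = z ^ k • w := by
    intro k
    induction k with
    | zero => simp
    | succ k ih => rw [pow_succ, ← vecMul_vecMul, ih, smul_vecMul, hwA, smul_smul, pow_succ]
  refine ⟨hAB w fun k => ?_, fun l => ?_⟩
  · rw [← vecMul_vecMul, hwpow, smul_vecMul]
    ext l
    have : (w ᵥ* B) l = w ⬝ᵥ B.col l := rfl
    rw [Pi.smul_apply, this, hz, smul_zero, Pi.zero_apply]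
  · have h1 := hq l
    rw [hz, map_zero, mul_eq_zero, or_iff_right (X_sub_C_ne_zero z), sub_eq_zero] at h1
    exact h1.symm

theorem Matrix.map_pow_ringHom {L : Type*} [Field L] (f : K →+* L) (A : Matrix σ σ K) (k : ℕ) :
    (A ^ k).map f = A.map f ^ k := by
  rw [← RingHom.mapMatrix_apply, map_pow, RingHom.mapMatrix_apply]

theorem Matrix.map_aeval_ringHom {L : Type*} [Field L] (f : K →+* L) (A : Matrix σ σ K) (a : K[X]) :
    (aeval A a).map f = aeval (A.map f) (a.map f) := by
  induction a using Polynomial.induction_on' with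
  | add p q hp hq =>
    rw [map_add, Matrix.map_add _ (map_add f), hp, hq, Polynomial.map_add, map_add]
  | monomial k x =>
    rw [aeval_monomial, map_monomial, aeval_monomial, ← Algebra.smul_def, ← Algebra.smul_def,
      Matrix.map_smul' _ _ _ (map_mul f), Matrix.map_pow_ringHom]

theorem IsAnnihilator.map {L : Type*} [Field L] (f : K →+* L) (h : IsAnnihilator A B c d a q) :
    IsAnnihilator (A.map f) (B.map f) (f ∘ c) (f ∘ d) (a.map f) fun l => (q l).map f := by
  refine ⟨?_, fun l => ?_⟩
  · rw [← Matrix.map_aeval_ringHom]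
    ext i
    rw [← RingHom.map_vecMul, h.1]
    simp
  · beta_reduce
    rw [← h.2 l]
    have hM : ∀ k, f (markov A c (B.col l) (d l) k) =
        markov (A.map f) (f ∘ c) ((B.map f).col l) ((f ∘ d) l) k := by
      intro k
      cases k with
      | zero => rfl
      | succ k =>
        rw [markov, markov, RingHom.map_dotProduct]
        congr 1
        ext i
        rw [Function.comp_apply, RingHom.map_mulVec, Matrix.map_pow_ringHom]
        rfl
    have hP : ∀ k, (powPolyPart (markov A c (B.col l) (d l)) k).map f =
        powPolyPart (markov (A.map f) (f ∘ c) ((B.map f).col l) ((f ∘ d) l)) k := by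
      intro k
      simp [powPolyPart, Polynomial.map_sum, hM]
    clear h
    induction a using Polynomial.induction_on' with
    | add p q hp hq => rw [Polynomial.map_add, map_add, hp, hq, map_add, Polynomial.map_add]
    | monomial k x =>
      rw [map_monomial, numer_monomial, numer_monomial, Polynomial.map_smul, hP]

/-- The matrices are real, so the real and imaginary parts of `w` can be tested separately. -/
theorem IsReachable.map_complex {A : Matrix σ σ ℝ} {B : Matrix σ ι ℝ} (h : IsReachable A B) :
    IsReachable (A.map (algebraMap ℝ ℂ)) (B.map (algebraMap ℝ ℂ)) := by
  intro w hw
  have key : ∀ (k : ℕ) (l : ι), ∑ i, w i * (((A ^ k * B : Matrix σ ι ℝ) i l : ℝ) : ℂ) = 0 := by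
    intro k l
    have h1 := congrFun (hw k) l
    rw [← Matrix.map_pow_ringHom, ← Matrix.map_mul] at h1
    simpa [vecMul, dotProduct] using h1
  have hre : (fun i => (w i).re) = 0 := by
    refine h _ fun k => ?_
    ext l
    simpa [vecMul, dotProduct] using congrArg Complex.re (key k l)
  have him : (fun i => (w i).im) = 0 := by
    refine h _ fun k => ?_
    ext l
    simpa [vecMul, dotProduct] using congrArg Complex.im (key k l)
  ext i
  exact Complex.ext (congrFun hre i) (congrFun him i)

/-- Polynomial relations evaluated along a trajectory. -/
theorem sum_coeff_mul_output [Fintype ι] {N : ℕ} {x : ℕ → σ → K} {u : ℕ → ι → K} {y : ℕ → K}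
    (hx : ∀ t ≤ N, x (t + 1) = A *ᵥ x t + B *ᵥ u t)
    (hy : ∀ t ≤ N, y t = c ⬝ᵥ x t + d ⬝ᵥ u t) (ha : a.natDegree ≤ N) :
    ∑ k ∈ Finset.range (N + 1), a.coeff k * y k = c ᵥ* aeval A a ⬝ᵥ x 0 +
      ∑ j ∈ Finset.range (N + 1), ∑ l, (numer A c (B.col l) (d l) a).coeff j * u j l := by
  have hstate : ∀ t ≤ N + 1, x t = A ^ t *ᵥ x 0 +
      ∑ j ∈ Finset.range t, A ^ (t - 1 - j) *ᵥ (B *ᵥ u j) := by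
    intro t
    induction t with
    | zero => simp
    | succ t ih =>
      intro ht
      rw [hx t (by omega), ih (by omega), mulVec_add, mulVec_mulVec, ← pow_succ', add_assoc,
        Finset.sum_range_succ]
      congr 2
      · rw [mulVec_sum]
        refine Finset.sum_congr rfl fun j hj => ?_
        rw [Finset.mem_range] at hj
        rw [mulVec_mulVec, ← pow_succ']
        congr 2
        omega
      · simp
  have hBcol : ∀ (k : ℕ) (v : ι → K), c ⬝ᵥ (A ^ k *ᵥ (B *ᵥ v)) =
      ∑ l, c ⬝ᵥ (A ^ k *ᵥ B.col l) * v l := by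
    intro k v
    rw [mulVec_mulVec, dotProduct_mulVec]
    simp only [dotProduct, vecMul]
    refine Finset.sum_congr rfl fun l _ => ?_
    rfl
  -- Padding with the zero coefficients at `j > t` gives all times the same range of summation, so
  -- that the weighted sum over `t` can be interchanged with it.
  have hout : ∀ t ≤ N, y t = c ᵥ* A ^ t ⬝ᵥ x 0 + ∑ j ∈ Finset.range (N + 1), ∑ l,
      (powPolyPart (markov A c (B.col l) (d l)) t).coeff j * u j l := by
    intro t ht
    have h1 : ∑ j ∈ Finset.range (N + 1), ∑ l,
        (powPolyPart (markov A c (B.col l) (d l)) t).coeff j * u j l =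
        ∑ j ∈ Finset.range (t + 1), ∑ l, markov A c (B.col l) (d l) (t - j) * u j l := by
      symm
      rw [← Finset.sum_subset (Finset.range_mono (Nat.succ_le_succ ht))]
      · refine Finset.sum_congr rfl fun j hj => Finset.sum_congr rfl fun l _ => ?_
        rw [Finset.mem_range] at hj
        rw [coeff_powPolyPart, if_pos (by omega)]
      · intro j _ hj
        rw [Finset.mem_range] at hj
        refine Finset.sum_eq_zero fun l _ => ?_
        rw [coeff_powPolyPart, if_neg (by omega), zero_mul]
    rw [h1, hy t ht, hstate t (by omega), dotProduct_add, ← dotProduct_mulVec, add_assoc,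
      Finset.sum_range_succ, dotProduct_sum]
    congr 2
    · refine Finset.sum_congr rfl fun j hj => ?_
      rw [Finset.mem_range] at hj
      rw [hBcol]
      refine Finset.sum_congr rfl fun l _ => ?_
      rw [show t - j = (t - 1 - j) + 1 by omega, markov]
    · simp [markov, dotProduct]
  have hasum := Polynomial.as_sum_range' a (N + 1) (by omega)
  have hnum : ∀ l j, (numer A c (B.col l) (d l) a).coeff j =
      ∑ k ∈ Finset.range (N + 1), a.coeff k *
        (powPolyPart (markov A c (B.col l) (d l)) k).coeff j := by
    intro l j
    conv_lhs => rw [hasum]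
    simp [Polynomial.finsetSum_coeff, numer_monomial]
  have haev : c ᵥ* aeval A a ⬝ᵥ x 0 =
      ∑ k ∈ Finset.range (N + 1), a.coeff k * (c ᵥ* A ^ k ⬝ᵥ x 0) := by
    conv_lhs => rw [hasum]
    rw [map_sum, ← dotProduct_mulVec, sum_mulVec, dotProduct_sum]
    refine Finset.sum_congr rfl fun k _ => ?_
    rw [aeval_monomial, ← Algebra.smul_def, smul_mulVec, dotProduct_smul, smul_eq_mul,
      dotProduct_mulVec]
  rw [haev]
  simp only [hnum, Finset.sum_mul]
  rw [Finset.sum_congr rfl fun k hk => by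
    rw [hout k (Nat.lt_succ_iff.mp (Finset.mem_range.mp hk)), mul_add],
    Finset.sum_add_distrib]
  congr 1
  simp only [Finset.mul_sum]
  rw [Finset.sum_comm]
  refine Finset.sum_congr rfl fun j _ => ?_
  rw [Finset.sum_comm]
  refine Finset.sum_congr rfl fun l _ => Finset.sum_congr rfl fun k _ => ?_
  ring

end Annihilator

/-! ### From rational transfer functions to polynomial relations -/

section Transfer

variable {σ ι : Type*} [Fintype σ] [DecidableEq σ]

/-- The matrix `zI - A` over the rational functions. -/
def pencil (A : Matrix σ σ ℝ) : Matrix σ σ (RatFunc ℝ) :=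
  (RatFunc.X : RatFunc ℝ) • (1 : Matrix σ σ (RatFunc ℝ)) - A.map RatFunc.C

/-- The rational function `c (zI - A)⁻¹ b`. -/
def strictTransfer (A : Matrix σ σ ℝ) (c b : σ → ℝ) : RatFunc ℝ :=
  (RatFunc.C ∘ c) ⬝ᵥ ((pencil A)⁻¹ *ᵥ (RatFunc.C ∘ b))

theorem isUnit_det_pencil (A : Matrix σ σ ℝ) : IsUnit (pencil A).det := by
  have h : pencil A = (charmatrix A).map (algebraMap ℝ[X] (RatFunc ℝ)) := by
    ext i j
    by_cases hij : i = j
    · subst hij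
      simp [pencil, RatFunc.algebraMap_X, RatFunc.algebraMap_C]
    · simp [pencil, hij, RatFunc.algebraMap_C]
  have h2 : (pencil A).det = algebraMap ℝ[X] (RatFunc ℝ) A.charpoly := by
    rw [h, Matrix.charpoly, RingHom.map_det]
    rfl
  rw [h2, isUnit_iff_ne_zero, Ne, map_eq_zero_iff _ (IsFractionRing.injective ℝ[X] (RatFunc ℝ))]
  exact A.charpoly_monic.ne_zero

variable (A : Matrix σ σ ℝ)

theorem strictTransfer_add (c c' b : σ → ℝ) :
    strictTransfer A (c + c') b = strictTransfer A c b + strictTransfer A c' b := by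
  rw [strictTransfer, strictTransfer, strictTransfer, ← add_dotProduct]
  congr 1
  ext i
  simp

theorem strictTransfer_smul (r : ℝ) (c b : σ → ℝ) :
    strictTransfer A (r • c) b = RatFunc.C r * strictTransfer A c b := by
  rw [strictTransfer, strictTransfer, ← smul_eq_mul, ← smul_dotProduct]
  congr 1
  ext i
  simp

theorem strictTransfer_vecMul (c b : σ → ℝ) :
    strictTransfer A (c ᵥ* A) b = RatFunc.X * strictTransfer A c b - RatFunc.C (c ⬝ᵥ b) := by
  have h1 : A.map RatFunc.C * (pencil A)⁻¹ = (RatFunc.X : RatFunc ℝ) • (pencil A)⁻¹ - 1 := by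
    have h2 := Matrix.mul_nonsing_inv (pencil A) (isUnit_det_pencil A)
    nth_rewrite 1 [pencil] at h2
    rw [Matrix.sub_mul, Matrix.smul_mul, Matrix.one_mul] at h2
    rw [← h2]
    abel
  have h3 : (RatFunc.C ∘ (c ᵥ* A) : σ → RatFunc ℝ) = (RatFunc.C ∘ c) ᵥ* A.map RatFunc.C := by
    ext i
    exact RingHom.map_vecMul RatFunc.C A c i
  rw [strictTransfer, h3, ← dotProduct_mulVec, mulVec_mulVec, h1, sub_mulVec, smul_mulVec,
    one_mulVec, dotProduct_sub, dotProduct_smul, smul_eq_mul, strictTransfer,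
    RingHom.map_dotProduct]

/-- Splits `a(z)G(z)` into its polynomial part and a strictly proper remainder, whose output vector
is `c a(A)`. -/
theorem mul_strictTransfer (c b : σ → ℝ) (d : ℝ) (a : ℝ[X]) :
    algebraMap ℝ[X] (RatFunc ℝ) a * (strictTransfer A c b + RatFunc.C d) =
      algebraMap ℝ[X] (RatFunc ℝ) (numer A c b d a) +
        strictTransfer A (c ᵥ* aeval A a) b := by
  induction a using Polynomial.induction_on with
  | C r =>
    have h1 : numer A c b d (C r) = C (r * d) := by
      rw [← mul_one (C r), ← smul_eq_C_mul, map_smul, numer_one, smul_C, smul_eq_mul]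
    rw [h1, aeval_C, Algebra.algebraMap_eq_smul_one (A := Matrix σ σ ℝ) r, vecMul_smul, vecMul_one,
      strictTransfer_smul, RatFunc.algebraMap_C, RatFunc.algebraMap_C, map_mul]
    ring
  | add p q hp hq =>
    rw [map_add, add_mul, hp, hq, map_add, map_add, map_add, vecMul_add, strictTransfer_add]
    ring
  | monomial k r hk =>
    rw [show C r * X ^ (k + 1) = X * (C r * X ^ k) by ring]
    generalize C r * X ^ k = p at hk ⊢
    rw [numer_X_mul, map_mul, mul_assoc, hk, map_add, map_mul, RatFunc.algebraMap_X,
      RatFunc.algebraMap_C, mul_comm X p, map_mul (aeval A), aeval_X, ← vecMul_vecMul,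
      strictTransfer_vecMul]
    ring

/-- A strictly proper polynomial is zero: multiplying by the characteristic polynomial `χ` removes
the remainder by Cayley-Hamilton and leaves a polynomial of degree less than that of `χ`. -/
theorem strictTransfer_eq_zero_of_polynomial {c b : σ → ℝ} {f : ℝ[X]}
    (h : strictTransfer A c b = algebraMap ℝ[X] (RatFunc ℝ) f) : strictTransfer A c b = 0 := by
  have h1 := mul_strictTransfer A c b 0 A.charpoly
  have hz : strictTransfer A 0 b = 0 := by
    have := strictTransfer_smul A 0 0 b
    simpa using this
  rw [map_zero, add_zero, Matrix.aeval_self_charpoly, vecMul_zero, hz, add_zero, h, ← map_mul] at h1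
  have h2 := IsFractionRing.injective ℝ[X] (RatFunc ℝ) h1
  have hχ := A.charpoly_monic.ne_zero
  have h3 := degree_numer_lt A c b hχ
  rw [← h2] at h3
  by_cases hf : f = 0
  · rw [h, hf, map_zero]
  · rw [degree_mul, degree_eq_natDegree hχ, degree_eq_natDegree hf] at h3
    norm_cast at h3
    omega

theorem dotProduct_eq_zero_of_strictTransfer_eq_zero {c b : σ → ℝ}
    (h : strictTransfer A c b = 0) : c ⬝ᵥ b = 0 ∧ strictTransfer A (c ᵥ* A) b = 0 := by
  have h1 := strictTransfer_vecMul A c b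
  rw [h, mul_zero, zero_sub, ← map_neg, ← RatFunc.algebraMap_C] at h1
  have h2 := strictTransfer_eq_zero_of_polynomial A h1
  refine ⟨?_, h2⟩
  rw [h2, eq_comm, map_eq_zero_iff _ (IsFractionRing.injective ℝ[X] (RatFunc ℝ)), C_eq_zero,
    neg_eq_zero] at h1
  exact h1

/-- A polynomial left fraction of the transfer function of a reachable system annihilates its
trajectories. -/
theorem isAnnihilator_of_transfer {B : Matrix σ ι ℝ} {c : σ → ℝ} {d : ι → ℝ}
    (hAB : IsReachable A B) {a : ℝ[X]} {q : ι → ℝ[X]}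
    (h : ∀ l, algebraMap ℝ[X] (RatFunc ℝ) a * (strictTransfer A c (B.col l) + RatFunc.C (d l)) =
      algebraMap ℝ[X] (RatFunc ℝ) (q l)) : IsAnnihilator A B c d a q := by
  have h1 : ∀ l, strictTransfer A (c ᵥ* aeval A a) (B.col l) =
      algebraMap ℝ[X] (RatFunc ℝ) (q l - numer A c (B.col l) (d l) a) := by
    intro l
    rw [map_sub, ← h l, mul_strictTransfer]
    ring
  have h2 := fun l => strictTransfer_eq_zero_of_polynomial A (h1 l)
  refine ⟨hAB _ fun k => ?_, fun l => ?_⟩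
  · have h3 : ∀ l, strictTransfer A (c ᵥ* aeval A a ᵥ* A ^ k) (B.col l) = 0 := by
      induction k with
      | zero => simpa using h2
      | succ k ih =>
        intro l
        rw [pow_succ, ← vecMul_vecMul]
        exact (dotProduct_eq_zero_of_strictTransfer_eq_zero A (ih l)).2
    ext l
    rw [← vecMul_vecMul]
    exact (dotProduct_eq_zero_of_strictTransfer_eq_zero A (h3 l)).1
  · have h3 := h1 l
    rw [h2, eq_comm, map_eq_zero_iff _ (IsFractionRing.injective ℝ[X] (RatFunc ℝ)),
      sub_eq_zero] at h3
    exact h3.symm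

end Transfer

/-! ### Minimality implies reachability -/

section Realization

variable {m p n : ℕ}

theorem StateSpace.transferMatrix_apply (S : StateSpace m p n) (i : Fin p) (j : Fin m) :
    S.transferMatrix i j = strictTransfer S.A (S.C i) (S.B.col j) + RatFunc.C (S.D i j) := by
  rw [StateSpace.transferMatrix, Matrix.add_apply, Matrix.map_apply, Matrix.mul_assoc,
    strictTransfer]
  rfl

/-- A minimal realization is reachable. -/
theorem StateSpace.isReachable_of_minimal (S : StateSpace m p n)
    (hn : minimalOrder S.transferMatrix = n) : IsReachable S.A S.B := by
  intro w hw
  by_contra hw0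
  -- The reachable space. If it were proper, the restriction of the system to it, with `AP = PA'`
  -- and `B = PB'` for a basis matrix `P`, would be a smaller realization.
  let V : Submodule ℝ (Fin n → ℝ) :=
    Submodule.span ℝ (Set.range fun q : ℕ × Fin m => (S.A ^ q.1 * S.B).col q.2)
  have hVtop : V < ⊤ := by
    rw [lt_top_iff_ne_top]
    intro htop
    apply hw0
    have h1 : ∀ v ∈ V, w ⬝ᵥ v = 0 := by
      intro v hv
      induction hv using Submodule.span_induction with
      | mem v hv =>
        obtain ⟨⟨k, l⟩, rfl⟩ := hv
        exact congrFun (hw k) l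
      | zero => simp
      | add v v' _ _ hv hv' => rw [dotProduct_add, hv, hv', add_zero]
      | smul r v _ hv => rw [dotProduct_smul, hv, smul_zero]
    exact dotProduct_self_eq_zero.mp (h1 w (htop ▸ Submodule.mem_top))
  set r := Module.finrank ℝ V with hr
  have hrn : r < n := by
    have := Submodule.finrank_lt hVtop.ne
    simpa using this
  let b : Module.Basis (Fin r) ℝ V := Module.finBasis ℝ V
  let P : Matrix (Fin n) (Fin r) ℝ := Matrix.of fun i j => (b j : Fin n → ℝ) i
  have hfac : ∀ {κ : Type} (M : Matrix (Fin n) κ ℝ), (∀ k, M.col k ∈ V) →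
      ∃ M' : Matrix (Fin r) κ ℝ, M = P * M' := by
    intro κ M hM
    refine ⟨Matrix.of fun j k => b.repr ⟨M.col k, hM k⟩ j, ?_⟩
    ext i k
    have h1 := congrArg (fun v : V => (v : Fin n → ℝ) i) (b.sum_repr ⟨M.col k, hM k⟩)
    simp only [AddSubmonoidClass.coe_finsetSum, Finset.sum_apply, Submodule.coe_smul,
      Pi.smul_apply, smul_eq_mul, Matrix.col_apply] at h1
    rw [← h1, Matrix.mul_apply]
    exact Finset.sum_congr rfl fun j _ => mul_comm _ _
  have hVA : ∀ v ∈ V, S.A *ᵥ v ∈ V := by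
    intro v hv
    induction hv using Submodule.span_induction with
    | mem v hv =>
      obtain ⟨⟨k, l⟩, rfl⟩ := hv
      refine Submodule.subset_span ⟨(k + 1, l), ?_⟩
      simp only [pow_succ', Matrix.mul_assoc]
      rfl
    | zero => simp
    | add v v' _ _ hv hv' => rw [mulVec_add]; exact V.add_mem hv hv'
    | smul r v _ hv => rw [mulVec_smul]; exact V.smul_mem r hv
  obtain ⟨A', hA'⟩ := hfac (S.A * P) fun j => hVA _ (b j).2
  obtain ⟨B', hB'⟩ := hfac S.B fun l => Submodule.subset_span ⟨(0, l), by simp⟩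
  let S' : StateSpace m p r := ⟨A', B', S.C * P, S.D⟩
  have htr : S'.transferMatrix = S.transferMatrix := by
    have h1 : pencil S.A * P.map RatFunc.C = P.map RatFunc.C * pencil A' := by
      rw [pencil, pencil, Matrix.sub_mul, Matrix.mul_sub, ← Matrix.map_mul, ← Matrix.map_mul, hA',
        Matrix.smul_mul, Matrix.mul_smul, Matrix.one_mul, Matrix.mul_one]
    have h2 : (pencil S.A)⁻¹ * P.map RatFunc.C = P.map RatFunc.C * (pencil A')⁻¹ := by
      calc (pencil S.A)⁻¹ * P.map RatFunc.C
          = (pencil S.A)⁻¹ * (P.map RatFunc.C * (pencil A' * (pencil A')⁻¹)) := by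
            rw [Matrix.mul_nonsing_inv _ (isUnit_det_pencil A'), Matrix.mul_one]
        _ = (pencil S.A)⁻¹ * pencil S.A * (P.map RatFunc.C * (pencil A')⁻¹) := by
            rw [← Matrix.mul_assoc (P.map _), ← h1]
            simp only [Matrix.mul_assoc]
        _ = _ := by rw [Matrix.nonsing_inv_mul _ (isUnit_det_pencil S.A), Matrix.one_mul]
    change (S.C * P).map RatFunc.C * (pencil A')⁻¹ * B'.map RatFunc.C + S.D.map RatFunc.C =
      S.C.map RatFunc.C * (pencil S.A)⁻¹ * S.B.map RatFunc.C + S.D.map RatFunc.C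
    rw [hB', Matrix.map_mul, Matrix.map_mul, Matrix.mul_assoc (S.C.map _), ← h2]
    simp only [Matrix.mul_assoc]
  have : minimalOrder S.transferMatrix ≤ r := Nat.sInf_le ⟨S', htr⟩
  omega

end Realization

/-! ### Data matrices and the minimum norm predictor -/

section Data

theorem IsMoorePenrose.vecMul_vecMul_vecMul {ρ κ : Type*} [Fintype ρ] [Fintype κ]
    {M : Matrix ρ κ ℝ} {X : Matrix κ ρ ℝ} (h : IsMoorePenrose M X) (g : ρ → ℝ) :
    g ᵥ* M ᵥ* X ᵥ* M = g ᵥ* M := by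
  rw [vecMul_vecMul, vecMul_vecMul, ← Matrix.mul_assoc, h.mul_mul_left]

/-- The minimum norm property: `MX` is the orthogonal projection onto the column space of `M`, and
`y X = (y X)(MX)` lies in that space. -/
theorem IsMoorePenrose.dotProduct_eq_zero {ρ κ : Type*} [Fintype ρ] [Fintype κ]
    {M : Matrix ρ κ ℝ} {X : Matrix κ ρ ℝ} (h : IsMoorePenrose M X) (y : κ → ℝ) {g : ρ → ℝ}
    (hg : g ᵥ* M = 0) : (y ᵥ* X) ⬝ᵥ g = 0 := by
  have h1 : y ᵥ* X = y ᵥ* X ᵥ* (M * X) := by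
    rw [vecMul_vecMul, ← Matrix.mul_assoc, h.mul_mul_right]
  rw [h1, ← dotProduct_mulVec, ← h.symm_left, mulVec_transpose, ← vecMul_vecMul, hg, zero_vecMul,
    dotProduct_zero]

variable {K σ ι : Type*} [Field K] [Fintype σ] [DecidableEq σ] [Fintype ι]

theorem sum_coeff_mul_output_fin {A : Matrix σ σ K} {B : Matrix σ ι K} {c : σ → K} {d : ι → K}
    {a : K[X]} {N : ℕ} {x : ℕ → σ → K} {u : Fin (N + 1) → ι → K} {y : Fin (N + 1) → K}
    (hx : ∀ t : Fin (N + 1), x (t + 1) = A *ᵥ x t + B *ᵥ u t)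
    (hy : ∀ t : Fin (N + 1), y t = c ⬝ᵥ x t + d ⬝ᵥ u t) (ha : a.natDegree ≤ N) :
    ∑ k : Fin (N + 1), a.coeff k * y k = c ᵥ* aeval A a ⬝ᵥ x 0 +
      ∑ j : Fin (N + 1), ∑ l, (numer A c (B.col l) (d l) a).coeff j * u j l := by
  have h := sum_coeff_mul_output (A := A) (B := B) (c := c) (d := d) (a := a) (N := N) (x := x)
    (u := fun t => if ht : t < N + 1 then u ⟨t, ht⟩ else 0)
    (y := fun t => if ht : t < N + 1 then y ⟨t, ht⟩ else 0)
    (fun t ht => by rw [dif_pos (Nat.lt_succ_of_le ht)]; exact hx ⟨t, _⟩)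
    (fun t ht => by
      rw [dif_pos (Nat.lt_succ_of_le ht), dif_pos (Nat.lt_succ_of_le ht)]; exact hy ⟨t, _⟩) ha
  rw [Finset.sum_range, Finset.sum_range] at h
  simpa only [Fin.is_lt, dif_pos] using h

variable {m p n N T : ℕ}

theorem vecMul_outputDataMatrix_apply (U : Matrix (Fin (N + 1) × Fin m) (Fin T) ℝ)
    (Y : Matrix (Fin (N + 1) × Fin p) (Fin T) ℝ) (i : Fin p)
    (v : ((Fin N × Fin m) ⊕ Fin m) ⊕ Fin N → ℝ) (c : Fin T) :
    (v ᵥ* outputDataMatrix U Y i) c =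
      ∑ k : Fin N, ∑ l, v (Sum.inl (Sum.inl (k, l))) * U (k.castSucc, l) c +
        ∑ l, v (Sum.inl (Sum.inr l)) * U (Fin.last N, l) c +
          ∑ k : Fin N, v (Sum.inr k) * Y (k.castSucc, i) c := by
  simp [vecMul, dotProduct, Fintype.sum_sum_type, Fintype.sum_prod_type, outputDataMatrix,
    pastData, futureData]

/-- The coefficients of `z^N y = (z^N - a(z)) y + q(z) u` in the order of the rows of `H_i`. -/
def coeffVec (N : ℕ) (a : K[X]) (q : Fin m → K[X]) :
    ((Fin N × Fin m) ⊕ Fin m) ⊕ Fin N → K :=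
  Sum.elim (Sum.elim (fun r => (q r.2).coeff r.1) fun l => (q l).coeff N) fun k => -a.coeff k

/-- The matrix `[U; X_0]` of the inputs and the initial states of the experiments. -/
def inputStateMatrix (U : Matrix (Fin (N + 1) × Fin m) (Fin T) ℝ) (x : Fin T → ℕ → Fin n → ℝ) :
    Matrix ((Fin (N + 1) × Fin m) ⊕ Fin n) (Fin T) ℝ :=
  fromRows U (Matrix.of fun i c => x c 0 i)

/-- The data matrices are made of trajectories with states `x`. -/
def IsStateOfData (S : StateSpace m p n) (U : Matrix (Fin (N + 1) × Fin m) (Fin T) ℝ)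
    (Y : Matrix (Fin (N + 1) × Fin p) (Fin T) ℝ) (x : Fin T → ℕ → Fin n → ℝ) : Prop :=
  ∀ (c : Fin T) (t : Fin (N + 1)),
    x c (t + 1) = S.A *ᵥ x c t + S.B *ᵥ (fun l => U (t, l) c) ∧
      (fun i => Y (t, i) c) = S.C *ᵥ x c t + S.D *ᵥ (fun l => U (t, l) c)

variable {S : StateSpace m p n} {U : Matrix (Fin (N + 1) × Fin m) (Fin T) ℝ}
  {Y : Matrix (Fin (N + 1) × Fin p) (Fin T) ℝ} {x : Fin T → ℕ → Fin n → ℝ}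

theorem IsStateOfData.sum_coeff_mul (hx : IsStateOfData S U Y x) (i : Fin p) {a : ℝ[X]}
    (ha : a.natDegree ≤ N) (c : Fin T) :
    ∑ k : Fin (N + 1), a.coeff k * Y (k, i) c = S.C i ᵥ* aeval S.A a ⬝ᵥ x c 0 +
      ∑ j : Fin (N + 1), ∑ l,
        (numer S.A (S.C i) (S.B.col l) (S.D i l) a).coeff j * U (j, l) c :=
  sum_coeff_mul_output_fin (u := fun t l => U (t, l) c) (fun t => (hx c t).1)
    (fun t => congrFun (hx c t).2 i) ha

theorem IsStateOfData.sum_coeff_mul_complex (hx : IsStateOfData S U Y x) (i : Fin p) {a : ℂ[X]}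
    (ha : a.natDegree ≤ N) {q : Fin m → ℂ[X]}
    (h : IsAnnihilator (S.A.map (algebraMap ℝ ℂ)) (S.B.map (algebraMap ℝ ℂ))
      (algebraMap ℝ ℂ ∘ S.C i) (algebraMap ℝ ℂ ∘ S.D i) a q) (c : Fin T) :
    ∑ k : Fin (N + 1), a.coeff k * Y (k, i) c =
      ∑ j : Fin (N + 1), ∑ l, (q l).coeff j * U (j, l) c := by
  have h1 := sum_coeff_mul_output_fin (A := S.A.map (algebraMap ℝ ℂ))
    (B := S.B.map (algebraMap ℝ ℂ)) (c := algebraMap ℝ ℂ ∘ S.C i) (d := algebraMap ℝ ℂ ∘ S.D i)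
    (x := fun t => algebraMap ℝ ℂ ∘ x c t) (u := fun t l => (U (t, l) c : ℂ))
    (y := fun t => (Y (t, i) c : ℂ)) (a := a)
    (fun t => by
      ext s
      have := congrArg (algebraMap ℝ ℂ) (congrFun (hx c t).1 s)
      rw [Pi.add_apply, map_add, RingHom.map_mulVec, RingHom.map_mulVec] at this
      exact this)
    (fun t => by
      have := congrArg (algebraMap ℝ ℂ) (congrFun (hx c t).2 i)
      rw [Pi.add_apply, map_add, RingHom.map_mulVec, RingHom.map_mulVec] at this
      exact this) ha
  rw [h.1, zero_dotProduct, zero_add] at h1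
  rw [h1]
  refine Finset.sum_congr rfl fun j _ => Finset.sum_congr rfl fun l _ => ?_
  rw [h.2]

/-- Past outputs are linear in the inputs and the initial state; for time `k` this is the trajectory
identity with `a = X ^ k`. -/
theorem IsStateOfData.exists_dataMatrix_eq (hx : IsStateOfData S U Y x) :
    ∃ F : Matrix (((Fin N × Fin m) ⊕ Fin m) ⊕ (Fin N × Fin p)) ((Fin (N + 1) × Fin m) ⊕ Fin n) ℝ,
      dataMatrix U Y = F * inputStateMatrix U x := by
  classical
  suffices h : ∀ r, ∃ v, ∀ c, dataMatrix U Y r c = (v ᵥ* inputStateMatrix U x) c by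
    choose F hF using h
    exact ⟨Matrix.of F, by ext r c; rw [hF]; rfl⟩
  have hU : ∀ k l, ∃ v, ∀ c, U (k, l) c = (v ᵥ* inputStateMatrix U x) c := fun k l =>
    ⟨Pi.single (Sum.inl (k, l)) 1, fun c => by simp [inputStateMatrix]⟩
  rintro ((⟨k, l⟩ | l) | ⟨k, i⟩)
  · exact hU k.castSucc l
  · exact hU (Fin.last N) l
  · refine ⟨Sum.elim
      (fun r => (numer S.A (S.C i) (S.B.col r.2) (S.D i r.2) (X ^ (k : ℕ))).coeff (r.1 : ℕ))
      (S.C i ᵥ* aeval S.A (X ^ (k : ℕ) : ℝ[X])), fun c => ?_⟩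
    have h1 := hx.sum_coeff_mul i (a := X ^ (k : ℕ)) (by rw [natDegree_X_pow]; omega) c
    have h2 : ∑ j : Fin (N + 1), (X ^ (k : ℕ) : ℝ[X]).coeff j * Y (j, i) c =
        Y (k.castSucc, i) c := by
      rw [Finset.sum_eq_single k.castSucc]
      · simp
      · intro j _ hj
        rw [coeff_X_pow, if_neg, zero_mul]
        exact fun h => hj (Fin.ext h)
      · simp
    rw [h2] at h1
    change Y (k.castSucc, i) c = _
    rw [h1]
    simp [vecMul, dotProduct, Fintype.sum_sum_type, Fintype.sum_prod_type, inputStateMatrix,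
      add_comm]

/-- The factorization through `[U; X_0]` forces the rank of that matrix up to its number of rows,
`m(N + 1) + n`. -/
theorem IsStateOfData.eq_zero_of_vecMul_eq_zero (hx : IsStateOfData S U Y x)
    (hrank : (dataMatrix U Y).rank = m * (N + 1) + n)
    {v : (Fin (N + 1) × Fin m) ⊕ Fin n → ℝ} (hv : v ᵥ* inputStateMatrix U x = 0) : v = 0 := by
  obtain ⟨F, hF⟩ := hx.exists_dataMatrix_eq
  have h1 : (dataMatrix U Y).rank ≤ (inputStateMatrix U x).rank := by
    rw [hF]
    exact rank_mul_le_right _ _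
  have h2 : LinearIndependent ℝ (inputStateMatrix U x).row := by
    rw [linearIndependent_iff_card_eq_finrank_span, Set.finrank, ← Matrix.rank_eq_finrank_span_row]
    refine le_antisymm ?_ (rank_le_card_height _)
    simp only [Fintype.card_sum, Fintype.card_prod, Fintype.card_fin]
    rw [mul_comm]
    omega
  rw [Fintype.linearIndependent_iff] at h2
  ext r
  refine h2 v ?_ r
  ext c
  rw [← hv]
  simp [vecMul, dotProduct, Finset.sum_apply]

/-- The polynomial `z^N - ∑ a_k z^k` of the predictor. -/
def predictorDen (h : ((Fin N × Fin m) ⊕ Fin m) ⊕ Fin N → ℝ) : ℝ[X] :=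
  X ^ N - ∑ k : Fin N, C (h (Sum.inr k)) * X ^ (k : ℕ)

/-- The polynomials `∑ b_k z^k` of the predictor. -/
def predictorNum (h : ((Fin N × Fin m) ⊕ Fin m) ⊕ Fin N → ℝ) (l : Fin m) : ℝ[X] :=
  ∑ k : Fin N, C (h (Sum.inl (Sum.inl (k, l)))) * X ^ (k : ℕ) + C (h (Sum.inl (Sum.inr l))) * X ^ N

theorem coeff_sum_fin {R : Type*} [Semiring R] (f : Fin N → R) (j : ℕ) :
    (∑ k : Fin N, C (f k) * X ^ (k : ℕ)).coeff j = if h : j < N then f ⟨j, h⟩ else 0 := by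
  rw [finsetSum_coeff]
  simp only [coeff_C_mul, coeff_X_pow, mul_ite, mul_one, mul_zero]
  split_ifs with h
  · rw [Finset.sum_eq_single ⟨j, h⟩]
    · simp
    · intro k _ hk
      rw [if_neg]
      rintro rfl
      exact hk rfl
    · simp
  · refine Finset.sum_eq_zero fun k _ => if_neg ?_
    have := k.2
    omega

variable (h : ((Fin N × Fin m) ⊕ Fin m) ⊕ Fin N → ℝ)

theorem coeff_predictorDen (k : Fin N) : (predictorDen h).coeff k = -h (Sum.inr k) := by
  rw [predictorDen, coeff_sub, coeff_sum_fin, dif_pos k.2, coeff_X_pow, if_neg k.2.ne, zero_sub]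

theorem coeff_predictorDen_top : (predictorDen h).coeff N = 1 := by
  rw [predictorDen, coeff_sub, coeff_sum_fin]
  simp

theorem natDegree_predictorDen_le : (predictorDen h).natDegree ≤ N := by
  rw [natDegree_le_iff_coeff_eq_zero]
  intro j hj
  rw [predictorDen, coeff_sub, coeff_sum_fin, coeff_X_pow, if_neg hj.ne', dif_neg (by omega),
    sub_zero]

theorem coeff_predictorNum (k : Fin N) (l : Fin m) :
    (predictorNum h l).coeff k = h (Sum.inl (Sum.inl (k, l))) := by
  rw [predictorNum, coeff_add, coeff_sum_fin (fun k => h (Sum.inl (Sum.inl (k, l)))), dif_pos k.2,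
    coeff_C_mul, coeff_X_pow, if_neg k.2.ne, mul_zero, add_zero]

theorem coeff_predictorNum_top (l : Fin m) :
    (predictorNum h l).coeff N = h (Sum.inl (Sum.inr l)) := by
  rw [predictorNum, coeff_add, coeff_sum_fin (fun k => h (Sum.inl (Sum.inl (k, l))))]
  simp

theorem natDegree_predictorNum_le (l : Fin m) : (predictorNum h l).natDegree ≤ N := by
  rw [natDegree_le_iff_coeff_eq_zero]
  intro j hj
  rw [predictorNum, coeff_add, coeff_sum_fin (fun k => h (Sum.inl (Sum.inl (k, l)))), coeff_C_mul,
    coeff_X_pow, if_neg hj.ne', dif_neg (by omega), mul_zero, add_zero]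

/-- If the last output is a linear function of the other data, the predictor reproduces it. -/
theorem predictor_vecMul (hx : IsStateOfData S U Y x) (i : Fin p) {a : ℝ[X]} {q : Fin m → ℝ[X]}
    (ha : a.natDegree ≤ N) (haN : a.coeff N = 1)
    (haq : IsAnnihilator S.A S.B (S.C i) (S.D i) a q) :
    predictor U Y i ᵥ* outputDataMatrix U Y i = futureData Y i := by
  -- The relation is solved for the last output, so `Y_{f,i}` lies in the row space of `H_i`, where
  -- `H_i^† H_i` acts as the identity.
  have h1 : coeffVec N a q ᵥ* outputDataMatrix U Y i = futureData Y i := by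
    ext c
    have h2 := hx.sum_coeff_mul i ha c
    rw [haq.1, zero_dotProduct, zero_add, Fin.sum_univ_castSucc, Fin.sum_univ_castSucc] at h2
    simp only [haq.2, Fin.val_castSucc, Fin.val_last, haN, one_mul] at h2
    rw [vecMul_outputDataMatrix_apply]
    simp only [coeffVec, Sum.elim_inl, Sum.elim_inr, neg_mul, Finset.sum_neg_distrib]
    change _ = Y (Fin.last N, i) c
    linarith
  rw [predictor, ← h1]
  exact (moorePenrose_spec _).vecMul_vecMul_vecMul _

/-- With persistently exciting data, an exact predictor annihilates the system. -/
theorem isAnnihilator_predictor (hx : IsStateOfData S U Y x)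
    (hrank : (dataMatrix U Y).rank = m * (N + 1) + n) (i : Fin p)
    (hh : h ᵥ* outputDataMatrix U Y i = futureData Y i) :
    IsAnnihilator S.A S.B (S.C i) (S.D i) (predictorDen h) (predictorNum h) := by
  -- The defect of the predictor as a relation of the system is a row vector that annihilates `[U;
  -- X_0]`.
  have key : Sum.elim (fun r : Fin (N + 1) × Fin m =>
      (numer S.A (S.C i) (S.B.col r.2) (S.D i r.2) (predictorDen h)).coeff r.1 -
        (predictorNum h r.2).coeff r.1) (S.C i ᵥ* aeval S.A (predictorDen h)) = 0 := by
    refine hx.eq_zero_of_vecMul_eq_zero hrank ?_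
    ext c
    have h1 := hx.sum_coeff_mul i (natDegree_predictorDen_le h) c
    have h2 := congrFun hh c
    rw [vecMul_outputDataMatrix_apply] at h2
    have h3 : ∑ j : Fin (N + 1), ∑ l, (predictorNum h l).coeff j * U (j, l) c =
        ∑ k : Fin (N + 1), (predictorDen h).coeff k * Y (k, i) c := by
      rw [Fin.sum_univ_castSucc, Fin.sum_univ_castSucc]
      simp only [Fin.val_castSucc, Fin.val_last, coeff_predictorDen, coeff_predictorDen_top,
        coeff_predictorNum, coeff_predictorNum_top, neg_mul, Finset.sum_neg_distrib, one_mul]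
      change _ = Y (Fin.last N, i) c at h2
      linarith
    have h4 : (Sum.elim (fun r : Fin (N + 1) × Fin m =>
        (numer S.A (S.C i) (S.B.col r.2) (S.D i r.2) (predictorDen h)).coeff r.1 -
          (predictorNum h r.2).coeff r.1) (S.C i ᵥ* aeval S.A (predictorDen h)) ᵥ*
            inputStateMatrix U x) c =
        (∑ j : Fin (N + 1), ∑ l,
          (numer S.A (S.C i) (S.B.col l) (S.D i l) (predictorDen h)).coeff j * U (j, l) c -
        ∑ j : Fin (N + 1), ∑ l, (predictorNum h l).coeff j * U (j, l) c) +
          S.C i ᵥ* aeval S.A (predictorDen h) ⬝ᵥ x c 0 := by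
      simp only [vecMul, dotProduct, Fintype.sum_sum_type, Fintype.sum_prod_type,
        inputStateMatrix, fromRows_apply_inl, fromRows_apply_inr, Sum.elim_inl, Sum.elim_inr,
        sub_mul, Finset.sum_sub_distrib, Matrix.of_apply]
    rw [h4, h3, h1, Pi.zero_apply]
    ring
  refine ⟨funext fun s => congrFun key (Sum.inr s), fun l => ?_⟩
  ext j
  by_cases hj : j < N + 1
  · exact sub_eq_zero.mp (congrFun key (Sum.inl (⟨j, hj⟩, l)))
  · rw [coeff_eq_zero_of_natDegree_lt, coeff_eq_zero_of_natDegree_lt]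
    · exact (natDegree_predictorNum_le h l).trans_lt (by omega)
    · exact ((natDegree_numer_le _ _ _ _ _).trans (natDegree_predictorDen_le h)).trans_lt
        (by omega)

/-- The minimum norm predictor is orthogonal to the annihilators of smaller order. -/
theorem predictor_orthogonal (hx : IsStateOfData S U Y x) (i : Fin p) {f : ℂ[X]}
    {g : Fin m → ℂ[X]} (hf : f.natDegree < N)
    (hfg : IsAnnihilator (S.A.map (algebraMap ℝ ℂ)) (S.B.map (algebraMap ℝ ℂ))
      (algebraMap ℝ ℂ ∘ S.C i) (algebraMap ℝ ℂ ∘ S.D i) f g) :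
    ∑ k : Fin (N + 1), ((predictorDen (predictor U Y i)).coeff k : ℂ) * f.coeff k +
      ∑ l, ∑ k : Fin (N + 1), ((predictorNum (predictor U Y i) l).coeff k : ℂ) * (g l).coeff k =
        0 := by
  have hfN : f.coeff N = 0 := coeff_eq_zero_of_natDegree_lt hf
  set h := predictor U Y i with hh
  -- Since `f` has degree below `N`, the last output does not enter, and the relation is one among
  -- the rows of `H_i` alone.
  have hker : ∀ c, ∑ k : Fin N, ∑ l, (g l).coeff k * (U (k.castSucc, l) c : ℂ) +
      ∑ l, (g l).coeff N * (U (Fin.last N, l) c : ℂ) -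
        ∑ k : Fin N, f.coeff k * (Y (k.castSucc, i) c : ℂ) = 0 := by
    intro c
    have h1 := hx.sum_coeff_mul_complex i hf.le hfg c
    rw [Fin.sum_univ_castSucc, Fin.sum_univ_castSucc] at h1
    simp only [Fin.val_castSucc, Fin.val_last, hfN, zero_mul, add_zero] at h1
    rw [← h1, sub_self]
  have hre : h ⬝ᵥ (fun r => (coeffVec N f g r).re) = 0 := by
    refine (moorePenrose_spec (outputDataMatrix U Y i)).dotProduct_eq_zero _ ?_
    ext c
    have h1 := congrArg Complex.re (hker c)
    rw [vecMul_outputDataMatrix_apply]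
    simpa [coeffVec, sub_eq_add_neg] using h1
  have him : h ⬝ᵥ (fun r => (coeffVec N f g r).im) = 0 := by
    refine (moorePenrose_spec (outputDataMatrix U Y i)).dotProduct_eq_zero _ ?_
    ext c
    have h1 := congrArg Complex.im (hker c)
    rw [vecMul_outputDataMatrix_apply]
    simpa [coeffVec, sub_eq_add_neg] using h1
  have hsum : ∑ r, (h r : ℂ) * coeffVec N f g r = 0 := by
    apply Complex.ext
    · simpa [dotProduct] using hre
    · simpa [dotProduct] using him
  rw [Finset.sum_comm (γ := Fin m), Fin.sum_univ_castSucc, Fin.sum_univ_castSucc]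
  -- The leading coefficient 1 of the predictor polynomial, which is no entry of `h`, meets `f.coeff
  -- N = 0`.
  simp only [Fin.val_castSucc, Fin.val_last, coeff_predictorDen, coeff_predictorDen_top,
    coeff_predictorNum, coeff_predictorNum_top, hfN]
  simp only [Fintype.sum_sum_type, Fintype.sum_prod_type, coeffVec, Sum.elim_inl,
    Sum.elim_inr] at hsum
  push_cast
  simp only [mul_neg, neg_mul, mul_zero, add_zero] at hsum ⊢
  linear_combination hsum

end Data

/-! ### Common roots of the predictor polynomials -/

section CommonRoots

/-- Pythagoras: `‖F‖² = ‖V‖² + |z|² ‖F‖²` with `V ≠ 0`. -/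
theorem norm_lt_one_of_orthogonal {κ : Type*} [Fintype κ] {F V : κ → ℂ} {z : ℂ} (hV : V ≠ 0)
    (horth : ∑ k, V k * star (F k) = 0)
    (hnorm : ∑ k, ‖V k + z * F k‖ ^ 2 = ∑ k, ‖F k‖ ^ 2) : ‖z‖ < 1 := by
  have h1 : ∑ k, ‖V k + z * F k‖ ^ 2 = ∑ k, ‖V k‖ ^ 2 + ‖z‖ ^ 2 * ∑ k, ‖F k‖ ^ 2 := by
    have h2 : ∀ k, ‖V k + z * F k‖ ^ 2 =
        ‖V k‖ ^ 2 + ‖z‖ ^ 2 * ‖F k‖ ^ 2 + 2 * (star z * (V k * star (F k))).re := by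
      intro k
      rw [← Complex.normSq_eq_norm_sq, ← Complex.normSq_eq_norm_sq, ← Complex.normSq_eq_norm_sq,
        ← Complex.normSq_eq_norm_sq, Complex.normSq_add, Complex.normSq_mul]
      congr 3
      simp only [map_mul, starRingEnd_apply]
      ring
    simp only [h2, Finset.sum_add_distrib, ← Finset.mul_sum, ← Complex.re_sum]
    rw [horth, mul_zero, Complex.zero_re, mul_zero, add_zero]
  have h3 : 0 < ∑ k, ‖V k‖ ^ 2 := by
    obtain ⟨k, hk⟩ := Function.ne_iff.mp hV
    exact Finset.sum_pos' (fun _ _ => by positivity)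
      ⟨k, Finset.mem_univ k, pow_pos (norm_pos_iff.mpr hk) 2⟩
  have h4 : 0 ≤ ∑ k, ‖F k‖ ^ 2 := Finset.sum_nonneg fun _ _ => by positivity
  by_contra hz
  push Not at hz
  have h5 := le_mul_of_one_le_left h4 (one_le_pow₀ hz (n := 2))
  linarith

/-- The shift is isometric as long as no coefficient leaves the window `0, …, N`. -/
theorem sum_norm_sq_coeff_X_mul {N : ℕ} {g : ℂ[X]} (hg : g.coeff N = 0) :
    ∑ k : Fin (N + 1), ‖(X * g).coeff k‖ ^ 2 = ∑ k : Fin (N + 1), ‖g.coeff k‖ ^ 2 := by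
  rw [Fin.sum_univ_succ, Fin.sum_univ_castSucc (fun k : Fin (N + 1) => ‖g.coeff k‖ ^ 2)]
  simp [hg, add_comm]

variable {m p n N T : ℕ} {S : StateSpace m p n} {U : Matrix (Fin (N + 1) × Fin m) (Fin T) ℝ}
  {Y : Matrix (Fin (N + 1) × Fin p) (Fin T) ℝ} {x : Fin T → ℕ → Fin n → ℝ}

/-- The polynomials of the minimum norm predictor have no common root on or outside the unit
circle. -/
theorem exists_predictorNum_ne_zero (hAB : IsReachable S.A S.B) (hx : IsStateOfData S U Y x)
    (i : Fin p) (hann : IsAnnihilator S.A S.B (S.C i) (S.D i) (predictorDen (predictor U Y i))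
      (predictorNum (predictor U Y i))) {z : ℂ} (hz : 1 ≤ ‖z‖)
    (hroot : aeval z (predictorDen (predictor U Y i)) = 0) :
    ∃ l, aeval z (predictorNum (predictor U Y i) l) ≠ 0 := by
  by_contra hcon
  push Not at hcon
  set P := predictorDen (predictor U Y i) with hP
  set Q := predictorNum (predictor U Y i) with hQ
  have hdvd : ∀ a : ℝ[X], aeval z a = 0 →
      ∃ f : ℂ[X], a.map (algebraMap ℝ ℂ) = (X - C z) * f := by
    intro a ha
    rw [← eval_map_algebraMap] at ha
    exact dvd_iff_isRoot.mpr ha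
  obtain ⟨f, hf⟩ := hdvd P hroot
  choose g hg using fun l => hdvd (Q l) (hcon l)
  have hcoeff : ∀ (a : ℝ[X]) (k : ℕ), (a.map (algebraMap ℝ ℂ)).coeff k = (a.coeff k : ℂ) :=
    fun a k => by simp
  have hann' := hann.map (algebraMap ℝ ℂ)
  rw [hf] at hann'
  simp only [hg] at hann'
  have hfg := hann'.of_X_sub_C_mul hAB.map_complex
  have hP0 : P.map (algebraMap ℝ ℂ) ≠ 0 := by
    intro h0
    have h1 := hcoeff P N
    rw [h0, hP, coeff_predictorDen_top] at h1
    simp at h1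
  have hf0 : f ≠ 0 := by
    rintro rfl
    exact hP0 (by rw [hf, mul_zero])
  have hdeg : f.natDegree < N := by
    have h1 : (P.map (algebraMap ℝ ℂ)).natDegree ≤ N :=
      (natDegree_map_le).trans (natDegree_predictorDen_le _)
    rw [hf, natDegree_mul (X_sub_C_ne_zero z) hf0, natDegree_X_sub_C] at h1
    omega
  have hgN : ∀ l, (g l).coeff N = 0 := by
    intro l
    refine coeff_eq_zero_of_natDegree_lt (lt_of_le_of_lt ?_ hdeg)
    rw [← hfg.2 l]
    exact natDegree_numer_le _ _ _ _ _
  have horth := predictor_orthogonal hx i hdeg hfg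
  rw [← hP, ← hQ] at horth
  -- `none` carries the output polynomial and `some l` those of the inputs, so that one norm covers
  -- the whole coefficient vector.
  let E : Option (Fin m) → ℂ[X] := fun o => o.elim f g
  let R : Option (Fin m) → ℂ[X] := fun o => o.elim (P.map (algebraMap ℝ ℂ))
    fun l => (Q l).map (algebraMap ℝ ℂ)
  have hER : ∀ o, R o = (X - C z) * E o := by
    rintro (_ | l)
    · exact hf
    · exact hg l
  have hEN : ∀ o, (E o).coeff N = 0 := by
    rintro (_ | l)
    · exact coeff_eq_zero_of_natDegree_lt hdeg
    · exact hgN l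
  -- Orthogonality to the kernel is bilinear; because `R` is real, conjugation turns it into the
  -- Hermitian orthogonality that Pythagoras needs.
  have hRreal : ∀ o k, star ((R o).coeff k) = (R o).coeff k := by
    rintro (_ | l) k <;> simp [R]
  refine absurd (norm_lt_one_of_orthogonal (z := z)
    (F := fun k : Option (Fin m) × Fin (N + 1) => (E k.1).coeff k.2)
    (V := fun k : Option (Fin m) × Fin (N + 1) => (R k.1).coeff k.2) ?_ ?_ ?_) hz.not_gt
  · intro h0
    have h1 := congrFun h0 (none, Fin.last N)
    change (P.map (algebraMap ℝ ℂ)).coeff N = 0 at h1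
    rw [hcoeff, hP, coeff_predictorDen_top] at h1
    simp at h1
  · have h1 : ∑ k : Option (Fin m) × Fin (N + 1), (R k.1).coeff k.2 * (E k.1).coeff k.2 = 0 := by
      rw [Fintype.sum_prod_type, Fintype.sum_option, ← horth]
      simp only [R, E, Option.elim_none, Option.elim_some, hcoeff]
    have h2 := congrArg star h1
    rw [star_sum, star_zero] at h2
    rw [← h2]
    refine Finset.sum_congr rfl fun k _ => ?_
    rw [star_mul', hRreal]
  · have h1 : ∀ k : Option (Fin m) × Fin (N + 1),
        (R k.1).coeff k.2 + z * (E k.1).coeff k.2 = (X * E k.1).coeff k.2 := by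
      intro k
      rw [hER, sub_mul, coeff_sub, coeff_C_mul, sub_add_cancel]
    have h2 : ∀ o, ∑ k : Fin (N + 1), ‖(X * E o).coeff k‖ ^ 2 =
        ∑ k : Fin (N + 1), ‖(E o).coeff k‖ ^ 2 := fun o => sum_norm_sq_coeff_X_mul (hEN o)
    simp only [h1, Fintype.sum_prod_type, h2]

/-- Two polynomial fractions with equal quotients have proportional numerators at a common root of
the denominators, if neither numerator vanishes there. -/
theorem exists_numerator_proportional {κ : Type*} {a b : ℝ[X]} (ha : a ≠ 0) (hb : b ≠ 0)
    {q r : κ → ℝ[X]} (hcross : ∀ l, a * r l = b * q l) {z : ℂ}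
    (hq : ∃ l, aeval z (q l) ≠ 0) (hr : ∃ l, aeval z (r l) ≠ 0) :
    ∃ s : ℂ, s ≠ 0 ∧ ∀ l, aeval z (q l) = s * aeval z (r l) := by
  have hinj := Polynomial.map_injective (algebraMap ℝ ℂ) (algebraMap ℝ ℂ).injective
  have hmap0 : ∀ {f : ℝ[X]}, f ≠ 0 → f.map (algebraMap ℝ ℂ) ≠ 0 := fun hf =>
    (Polynomial.map_ne_zero_iff (algebraMap ℝ ℂ).injective).mpr hf
  obtain ⟨a', ha', haz⟩ := exists_eq_pow_rootMultiplicity_mul_and_not_dvd _ (hmap0 ha) z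
  obtain ⟨b', hb', hbz⟩ := exists_eq_pow_rootMultiplicity_mul_and_not_dvd _ (hmap0 hb) z
  generalize rootMultiplicity z (a.map (algebraMap ℝ ℂ)) = μ at ha'
  generalize rootMultiplicity z (b.map (algebraMap ℝ ℂ)) = ν at hb'
  rw [dvd_iff_isRoot, IsRoot] at haz hbz
  have hc : ∀ l, (X - C z) ^ μ * (a' * (r l).map (algebraMap ℝ ℂ)) =
      (X - C z) ^ ν * (b' * (q l).map (algebraMap ℝ ℂ)) := by
    intro l
    have := congrArg (Polynomial.map (algebraMap ℝ ℂ)) (hcross l)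
    rw [Polynomial.map_mul, Polynomial.map_mul, ha', hb'] at this
    rw [← mul_assoc, this, mul_assoc]
  have hX : ∀ k, (X - C z) ^ k ≠ (0 : ℂ[X]) := fun k => pow_ne_zero k (X_sub_C_ne_zero z)
  obtain ⟨l₁, hl₁⟩ := hq
  obtain ⟨l₂, hl₂⟩ := hr
  -- With unequal multiplicities, cancelling the smaller power of `X - z` and evaluating at `z`
  -- would make one numerator vanish there.
  rcases lt_trichotomy μ ν with h | h | h
  · exfalso
    obtain ⟨k, rfl⟩ := Nat.exists_eq_add_of_lt h
    have h1 := hc l₂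
    rw [add_assoc, pow_add, mul_assoc] at h1
    have h2 := congrArg (eval z) (mul_left_cancel₀ (hX μ) h1)
    simp [haz, hl₂, eval_map_algebraMap] at h2
  · subst h
    refine ⟨eval z a' / eval z b', div_ne_zero haz hbz, fun l => ?_⟩
    have h2 := congrArg (eval z) (mul_left_cancel₀ (hX μ) (hc l))
    rw [eval_mul, eval_mul, eval_map_algebraMap, eval_map_algebraMap] at h2
    field_simp
    linear_combination -h2
  · exfalso
    obtain ⟨k, rfl⟩ := Nat.exists_eq_add_of_lt h
    have h1 := hc l₁
    rw [add_assoc, pow_add, mul_assoc] at h1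
    have h2 := congrArg (eval z) (mul_left_cancel₀ (hX ν) h1)
    simp [hbz, hl₁, eval_map_algebraMap] at h2

end CommonRoots

/-! ### Left eigenvectors of the shift blocks -/

section BlockEigenvectors

variable {m N : ℕ}

/-- The sequence `0, v_0, …, v_{N-1}, 0, …`. -/
def delay (v : Fin N → ℂ) : ℕ → ℂ
  | 0 => 0
  | k + 1 => if h : k < N then v ⟨k, h⟩ else 0

theorem delay_succ (v : Fin N → ℂ) (k : Fin N) : delay v (k + 1) = v k := by
  rw [delay, dif_pos k.2]

theorem sum_mul_ite_last (v : Fin N → ℂ) (y : ℂ) :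
    ∑ r : Fin N, v r * (if (r : ℕ) + 1 = N then y else 0) = delay v N * y := by
  cases N with
  | zero => simp [delay]
  | succ M =>
    rw [Fin.sum_univ_castSucc, Finset.sum_eq_zero]
    · have := delay_succ v (Fin.last M)
      simp_all
    · intro r _
      have := r.2
      rw [if_neg (by simp; omega), mul_zero]

theorem sum_mul_ite_succ (v : Fin N → ℂ) {c : ℕ} (hc : c ≤ N) :
    ∑ r : Fin N, v r * (if c = (r : ℕ) + 1 then 1 else 0) = delay v c := by
  cases c with
  | zero => simp [delay]
  | succ c =>
    rw [Finset.sum_eq_single ⟨c, hc⟩, ← delay_succ v ⟨c, hc⟩]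
    · simp
    · intro r _ hr
      rw [if_neg, mul_zero]
      intro h
      exact hr (Fin.ext (by simpa using h.symm))
    · simp

/-- Multiplied by `z ^ c`, the recurrence telescopes. -/
theorem sum_mul_pow_of_delay {v s : Fin N → ℂ} {z : ℂ}
    (h : ∀ c : Fin N, s c + delay v c = z * v c) : ∑ c, s c * z ^ (c : ℕ) = z ^ N * delay v N := by
  have h1 : ∀ c : Fin N, s c * z ^ (c : ℕ) =
      z ^ ((c : ℕ) + 1) * delay v (c + 1) - z ^ (c : ℕ) * delay v c := by
    intro c
    rw [delay_succ]
    linear_combination z ^ (c : ℕ) * h c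
  rw [Finset.sum_congr rfl fun c _ => h1 c,
    ← Finset.sum_range fun k => z ^ (k + 1) * delay v (k + 1) - z ^ k * delay v k,
    Finset.sum_range_sub fun k => z ^ k * delay v k]
  simp [delay]

/-- The recurrence runs backwards: each entry is determined by its successor, starting from the
vanishing last one. -/
theorem eq_zero_of_delay {v : Fin N → ℂ} {z : ℂ} (h : ∀ c : Fin N, delay v c = z * v c)
    (hN : delay v N = 0) : v = 0 := by
  have h1 : ∀ k ≤ N, delay v (N - k) = 0 := by
    intro k
    induction k with
    | zero => simpa using hN
    | succ k ih =>
      intro hk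
      have h2 := h ⟨N - (k + 1), by omega⟩
      rw [← delay_succ v, Fin.val_mk, show N - (k + 1) + 1 = N - k by omega, ih (by omega),
        mul_zero] at h2
      exact h2
  ext c
  rw [← delay_succ v c, Pi.zero_apply, show (c : ℕ) + 1 = N - (N - (c + 1)) by omega]
  exact h1 _ (by omega)

variable {h : ((Fin N × Fin m) ⊕ Fin m) ⊕ Fin N → ℝ} {v : Fin N ⊕ (Fin N × Fin m) → ℂ} {z : ℂ}

theorem delay_output_of_eigenvector (hv : v ᵥ* (blockA h).map (algebraMap ℝ ℂ) = z • v)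
    (c : Fin N) : delay (v ∘ Sum.inl) N * h (Sum.inr c) + delay (v ∘ Sum.inl) c =
      z * v (Sum.inl c) := by
  rw [← sum_mul_ite_last, ← sum_mul_ite_succ _ c.2.le, ← Finset.sum_add_distrib, ← smul_eq_mul z,
    ← Pi.smul_apply, ← hv]
  simp only [vecMul, dotProduct, Fintype.sum_sum_type, blockA, Matrix.map_apply,
    fromBlocks_apply₁₁, fromBlocks_apply₂₁, Matrix.of_apply, Matrix.zero_apply, map_zero, mul_zero,
    Finset.sum_const_zero, add_zero, Function.comp_apply]
  refine Finset.sum_congr rfl fun r _ => ?_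
  have := c.2
  by_cases h1 : (r : ℕ) + 1 = N
  · rw [if_pos h1, if_pos h1, if_neg (by omega)]
    simp
  · rw [if_neg h1, if_neg h1]
    split_ifs <;> simp

theorem delay_input_of_eigenvector (hv : v ᵥ* (blockA h).map (algebraMap ℝ ℂ) = z • v)
    (c : Fin N) (l : Fin m) :
    delay (v ∘ Sum.inl) N * h (Sum.inl (Sum.inl (c, l))) +
      delay (fun r => v (Sum.inr (r, l))) c = z * v (Sum.inr (c, l)) := by
  rw [← sum_mul_ite_last, ← sum_mul_ite_succ _ c.2.le, ← smul_eq_mul z, ← Pi.smul_apply, ← hv]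
  simp only [vecMul, dotProduct, Fintype.sum_sum_type, blockA, Matrix.map_apply,
    fromBlocks_apply₁₂, fromBlocks_apply₂₂, Matrix.of_apply, Fintype.sum_prod_type,
    Function.comp_apply]
  congr 1
  · refine Finset.sum_congr rfl fun r _ => ?_
    split_ifs <;> simp
  · refine Finset.sum_congr rfl fun r _ => ?_
    rw [Finset.sum_eq_single l]
    · by_cases h1 : (c : ℕ) = r + 1 <;> simp [h1]
    · intro l' _ hl'
      simp [hl'.symm]
    · simp

theorem vecMul_blockB_apply (v : Fin N ⊕ (Fin N × Fin m) → ℂ) (l : Fin m) :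
    (v ᵥ* (blockB h).map (algebraMap ℝ ℂ)) l =
      delay (v ∘ Sum.inl) N * h (Sum.inl (Sum.inr l)) +
        delay (fun r => v (Sum.inr (r, l))) N := by
  rw [← sum_mul_ite_last, ← mul_one (delay (fun r => v (Sum.inr (r, l))) N), ← sum_mul_ite_last]
  simp only [vecMul, dotProduct, Fintype.sum_sum_type, blockB, Matrix.map_apply,
    fromRows_apply_inl, fromRows_apply_inr, Matrix.of_apply, Fintype.sum_prod_type,
    Function.comp_apply]
  congr 1
  · refine Finset.sum_congr rfl fun r _ => ?_
    split_ifs <;> simp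
  · refine Finset.sum_congr rfl fun r _ => ?_
    rw [Finset.sum_eq_single l]
    · by_cases h1 : (r : ℕ) + 1 = N <;> simp [h1]
    · intro l' _ hl'
      simp [hl']
    · simp

theorem delay_mul_aeval_predictorDen (hv : v ᵥ* (blockA h).map (algebraMap ℝ ℂ) = z • v) :
    delay (v ∘ Sum.inl) N * aeval z (predictorDen h) = 0 := by
  have h1 := sum_mul_pow_of_delay (delay_output_of_eigenvector hv)
  simp only [predictorDen, map_sub, map_sum, map_mul, map_pow, aeval_X, aeval_C, mul_sub,
    Finset.mul_sum, ← mul_assoc]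
  rw [sub_eq_zero, mul_comm, ← h1]
  rfl

theorem pow_mul_vecMul_blockB (hv : v ᵥ* (blockA h).map (algebraMap ℝ ℂ) = z • v) (l : Fin m) :
    z ^ N * (v ᵥ* (blockB h).map (algebraMap ℝ ℂ)) l =
      delay (v ∘ Sum.inl) N * aeval z (predictorNum h l) := by
  have h1 := sum_mul_pow_of_delay (v := fun r => v (Sum.inr (r, l)))
    fun c => delay_input_of_eigenvector hv c l
  rw [vecMul_blockB_apply, mul_add, ← h1]
  simp only [predictorNum, map_add, map_sum, map_mul, map_pow, aeval_X, aeval_C, mul_add,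
    Finset.mul_sum, ← mul_assoc]
  rw [add_comm]
  congr 1
  rw [mul_comm (z ^ N), mul_right_comm]
  rfl

/-- Without the coupling through the last output entry, both parts are left eigenvectors of
nilpotent shifts, and `z ≠ 0`. -/
theorem eigenvector_eq_zero (hz : z ≠ 0) (hv : v ᵥ* (blockA h).map (algebraMap ℝ ℂ) = z • v)
    (hα : delay (v ∘ Sum.inl) N = 0) : v = 0 := by
  have h1 : v ∘ Sum.inl = 0 := by
    refine eq_zero_of_delay (z := z) (fun c => ?_) hα
    have := delay_output_of_eigenvector hv c
    rwa [hα, zero_mul, zero_add] at this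
  have h2 : ∀ l, (fun r => v (Sum.inr (r, l))) = 0 := by
    intro l
    have h3 : ∀ c : Fin N, delay (fun r => v (Sum.inr (r, l))) c = z * v (Sum.inr (c, l)) := by
      intro c
      have := delay_input_of_eigenvector hv c l
      rwa [hα, zero_mul, zero_add] at this
    refine eq_zero_of_delay h3 ?_
    have h4 := sum_mul_pow_of_delay (v := fun r => v (Sum.inr (r, l))) (s := 0)
      fun c => by rw [Pi.zero_apply, zero_add]; exact h3 c
    simp only [Pi.zero_apply, zero_mul, Finset.sum_const_zero] at h4
    exact (mul_eq_zero.mp h4.symm).resolve_left (pow_ne_zero N hz)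
  ext (c | ⟨c, l⟩)
  · exact congrFun h1 c
  · exact congrFun (h2 l) c

end BlockEigenvectors

end

/-! ### The main theorem -/

theorem corollary2 {m p n N T : ℕ}
    -- the system: transfer function matrix `G`, minimal order `n`, minimal realization `S`
    (G : Matrix (Fin p) (Fin m) (RatFunc ℝ)) (hn : minimalOrder G = n)
    (S : StateSpace m p n) (hS : S.transferMatrix = G)
    -- `G_i = N_i / D_i`, with `D_i` monic of degree the minimal order of `G_i`
    (den : Fin p → ℝ[X]) (num : Fin p → Fin m → ℝ[X])
    (hden_monic : ∀ i, (den i).Monic)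
    (hden_deg : ∀ i, (den i).natDegree = minimalOrder (outputRow G i))
    (hnum_deg : ∀ i j, (num i j).natDegree ≤ minimalOrder (outputRow G i))
    (hG : ∀ i j, G i j =
      algebraMap ℝ[X] (RatFunc ℝ) (num i j) / algebraMap ℝ[X] (RatFunc ℝ) (den i))
    -- the data: each column is an input-output trajectory of length `N + 1`
    (U : Matrix (Fin (N + 1) × Fin m) (Fin T) ℝ)
    (Y : Matrix (Fin (N + 1) × Fin p) (Fin T) ℝ)
    (hdata : ∀ c, ((fun t a => U (t, a) c), (fun t i => Y (t, i) c)) ∈ S.trajectories (N + 1))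
    -- the rank condition, with `N` at least the lag and, for several outputs, at least the
    -- minimal order of each `G_i` (for `p = 1` the latter follows from the former)
    (hrank : (dataMatrix U Y).rank = m * (N + 1) + n)
    (hlag : S.observabilityIndex ≤ N)
    (hN : 2 ≤ p → ∀ i, minimalOrder (outputRow G i) ≤ N)
    (hcond : p = 1 ∨
      ∀ z : ℂ, 1 ≤ ‖z‖ →
        LinearIndependent ℂ
          (fun (i : {i : Fin p // aeval z (den i) = 0}) (j : Fin m) => aeval z (num i j))) :
    IsStabilizable (realizationA U Y) (realizationB U Y) := by
  classical
  have hAB : IsReachable S.A S.B := S.isReachable_of_minimal (by rw [hS, hn])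
  obtain ⟨x, hx⟩ : ∃ x, IsStateOfData S U Y x := by
    choose x hx using hdata
    exact ⟨x, hx⟩
  have horder : ∀ i, minimalOrder (outputRow G i) ≤ N := by
    intro i
    by_cases hp : 2 ≤ p
    · exact hN hp i
    · obtain rfl : p = 1 := by have := i.2; omega
      have h1 : outputRow G i = G := by
        ext a b
        rw [Subsingleton.elim a i]
        rfl
      -- For a single output the data matrix has `m(N + 1) + N` rows, so its rank already gives `n ≤
      -- N`.
      have h2 := Matrix.rank_le_card_height (dataMatrix U Y)
      simp only [Fintype.card_sum, Fintype.card_prod, Fintype.card_fin] at h2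
      rw [h1, hn]
      rw [hrank] at h2
      linarith
  have hfrac : ∀ i, IsAnnihilator S.A S.B (S.C i) (S.D i) (den i) (num i) := by
    intro i
    refine isAnnihilator_of_transfer _ hAB fun l => ?_
    rw [← S.transferMatrix_apply, hS, hG, mul_div_cancel₀]
    rw [Ne, map_eq_zero_iff _ (IsFractionRing.injective ℝ[X] (RatFunc ℝ))]
    exact (hden_monic i).ne_zero
  have hpred : ∀ i, IsAnnihilator S.A S.B (S.C i) (S.D i) (predictorDen (predictor U Y i))
      (predictorNum (predictor U Y i)) := by
    intro i
    -- The power of `X` raises the degree to exactly `N`, so that the relation predicts the last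
    -- sample of the window.
    have hmonic : (X ^ (N - (den i).natDegree) * den i).Monic :=
      (monic_X_pow _).mul (hden_monic i)
    have hdeg : (X ^ (N - (den i).natDegree) * den i).natDegree = N := by
      have := horder i
      rw [← hden_deg i] at this
      rw [(monic_X_pow _).natDegree_mul (hden_monic i), natDegree_X_pow]
      omega
    refine isAnnihilator_predictor _ hx hrank i (predictor_vecMul hx i hdeg.le ?_
      ((hfrac i).mul_left (X ^ (N - (den i).natDegree))))
    have := hmonic.coeff_natDegree
    rwa [hdeg] at this
  have hpred0 : ∀ i, predictorDen (predictor U Y i) ≠ 0 := by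
    intro i h0
    have := coeff_predictorDen_top (predictor U Y i)
    rw [h0, coeff_zero] at this
    exact zero_ne_one this
  refine isStabilizable_of_hautus _ _ fun z w hz hwA hwB => ?_
  have hz0 : z ≠ 0 := norm_pos_iff.mp (zero_lt_one.trans_le hz)
  have hblock : ∀ i, (fun s => w (s, i)) ᵥ* (blockA (predictor U Y i)).map (algebraMap ℝ ℂ) =
      z • fun s => w (s, i) := by
    intro i
    ext s
    have h1 := congrFun hwA (s, i)
    rw [Pi.smul_apply] at h1 ⊢
    rw [← h1]
    simp only [vecMul, dotProduct, realizationA, Matrix.map_apply, Fintype.sum_prod_type,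
      blockDiagonal_apply]
    refine Finset.sum_congr rfl fun s' _ => ?_
    rw [Finset.sum_eq_single i]
    · simp
    · intro i' _ hi'
      simp [hi']
    · simp
  set α : Fin p → ℂ := fun i => delay ((fun s => w (s, i)) ∘ Sum.inl) N with hα
  have hαden : ∀ i, α i = 0 ∨ aeval z (predictorDen (predictor U Y i)) = 0 := fun i =>
    mul_eq_zero.mp (delay_mul_aeval_predictorDen (hblock i))
  have hαnum : ∀ l, ∑ i, α i * aeval z (predictorNum (predictor U Y i) l) = 0 := by
    intro l
    have h1 := congrFun hwB l
    have h2 : (w ᵥ* (realizationB U Y).map (algebraMap ℝ ℂ)) l =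
        ∑ i, ((fun s => w (s, i)) ᵥ* (blockB (predictor U Y i)).map (algebraMap ℝ ℂ)) l := by
      simp only [vecMul, dotProduct, realizationB, Matrix.map_apply, Fintype.sum_prod_type,
        Matrix.of_apply]
      exact Finset.sum_comm
    rw [h2, Pi.zero_apply] at h1
    rw [← Finset.sum_congr rfl fun i _ => pow_mul_vecMul_blockB (hblock i) l, ← Finset.mul_sum, h1,
      mul_zero]
  have hnz : ∀ i, aeval z (predictorDen (predictor U Y i)) = 0 →
      ∃ l, aeval z (predictorNum (predictor U Y i) l) ≠ 0 := fun i =>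
    exists_predictorNum_ne_zero hAB hx i (hpred i) hz
  suffices hα0 : ∀ i, α i = 0 by
    ext ⟨s, i⟩
    exact congrFun (eigenvector_eq_zero hz0 (hblock i) (hα0 i)) s
  rcases hcond with rfl | hcond
  · intro i
    refine (hαden i).elim id fun hroot => ?_
    obtain ⟨l, hl⟩ := hnz i hroot
    have h1 := hαnum l
    rw [Fintype.sum_subsingleton _ i] at h1
    exact (mul_eq_zero.mp h1).resolve_right hl
  · have hcross : ∀ i l, predictorDen (predictor U Y i) * num i l =
        den i * predictorNum (predictor U Y i) l := fun i l => (hpred i).cross (hfrac i) l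
    -- If `P_i(z) = 0` while `D_i(z) ≠ 0`, the cross relation would make `Q_i(z)` vanish too.
    have hαroot : ∀ i, aeval z (den i) ≠ 0 → α i = 0 := by
      intro i hi
      refine (hαden i).elim id fun hroot => ?_
      obtain ⟨l, hl⟩ := hnz i hroot
      have h1 := congrArg (aeval z) (hcross i l)
      rw [map_mul, map_mul, hroot, zero_mul] at h1
      exact absurd h1.symm (mul_ne_zero hi hl)
    have hprop : ∀ i : {i : Fin p // aeval z (den i) = 0}, ∃ s : ℂ, s ≠ 0 ∧
        ∀ l, α i * aeval z (predictorNum (predictor U Y i) l) = s * α i * aeval z (num i l) := by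
      intro i
      rcases hαden i with h0 | hroot
      · exact ⟨1, one_ne_zero, fun l => by rw [h0]; ring⟩
      · obtain ⟨s, hs, hsl⟩ := exists_numerator_proportional (hpred0 i) (hden_monic i).ne_zero
          (hcross i) (hnz i hroot) (Function.ne_iff.mp ((hcond z hz).ne_zero i))
        exact ⟨s, hs, fun l => by rw [hsl]; ring⟩
    choose s hs hsl using hprop
    -- The combination of the `N_i(z)` with weights `s_i α_i` equals `∑ α_i Q_i(z) = 0`; the indices
    -- with `D_i(z) ≠ 0` contribute nothing.
    have hlin := Fintype.linearIndependent_iff.mp (hcond z hz) (fun i => s i * α i) (by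
      ext l
      rw [Finset.sum_apply, Pi.zero_apply]
      refine Eq.trans ?_ (hαnum l)
      rw [← Finset.sum_filter_of_ne (p := fun i => aeval z (den i) = 0)
          (fun i _ hi => by_contra fun h => hi (by rw [hαroot i h, zero_mul])),
        ← Finset.sum_subtype_eq_sum_filter]
      refine Finset.sum_congr (by ext; simp) fun i _ => ?_
      rw [Pi.smul_apply, smul_eq_mul, hsl])
    intro i
    by_cases hi : aeval z (den i) = 0
    · exact (mul_eq_zero.mp (hlin ⟨i, hi⟩)).resolve_left (hs ⟨i, hi⟩)
    · exact hαroot i hi
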